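/- Let $\mathbb{K}$ be a field of characteristic zero, let $n,r$ be positive integers, and let $f=(f_1,\dots,f_r)$ be an $r$-tuple of non-zero polynomials in $\mathbb{K}[x]=\mathbb{K}[x_1,\dots,x_n]$. Let $D_n$ be the $n$-th Weyl algebra, and let $D_n\langle S\rangle = D_n\otimes_{\mathbb{K}} U(\mathfrak{gl}_r)$, where $U(\mathfrak{gl}_r)$ is generated by $s_{ij}$ ($1\le i,j\le r$) subject to $[s_{ij},s_{kl}]=\delta_{jk}s_{il}-\delta_{il}s_{kj}$. It acts on the free $\mathbb{K}[x,s,\tfrac1{f_1\cdots f_r}]$-module of rank one generated by the symbol $f^s=f_1^{s_1}\cdots f_r^{s_r}$, $s=(s_1,\dots,s_r)$: the $x_m$ act by multiplication, $$\partial_m\bullet (G f^s)=\Big(\frac{\partial G}{\partial x_m}+G\sum_{i=1}^r \frac{s_i}{f_i}\frac{\partial f_i}{\partial x_m}\Big) f^s,\qquad s_{ij}\bullet (G(s) f^s)=s_i\,G(s+\epsilon_j-\epsilon_i)\,\frac{f_j}{f_i}\,f^s ,$$ where $\epsilon_j$ is the $j$-th standard basis vector. The Bernstein–Sato polynomial $b_f(s)\in\mathbb{K}[s]$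 is the monic polynomial $b$ of lowest degree for which there are $P_1,\dots,P_r\in D_n\langle S\rangle$ with $$\sum_{k=1}^r P_k f_k\bullet f^s=b(s_1+\dots+s_r)\,f^s .$$ Let $D_n\langle t,\partial t\rangle$ be the Weyl algebra in $x_1,\dots,x_n,t_1,\dots,t_r$ and let $$I_f=\Big\langle t_i-f_i,\ \partial_m+\sum_{j=1}^r\frac{\partial f_j}{\partial x_m}\,\partial t_j\ \Big|\ 1\le i\le r,\ 1\le m\le n\Big\rangle$$ be the (left) Malgrange ideal of $f$. Give $x_m,\partial_m$ weight $0$, $t_j$ weight $-1$ and $\partial t_j$ weight $1$. The initial form of a non-zero element, written in the basis of monomials $x^{\alpha}t^{\gamma}\partial^{\beta}\partial t^{\delta}$, is the sum of its terms of maximal weight, and $\mathrm{in}(I_f)$ is the $\mathbb{K}$-span of the initial forms of the elements of $I_f$. The b-function of $I_f$ with respect to this weight is the monic generator $B(s)$ of the ideal $\{p\in\mathbb{K}[s] : p(t_1\partial t_1+\dots+t_r\partial t_r)\in \mathrm{in}(I_f)\}$ of $\mathbb{K}[s]$. Then, for $B\in\mathbb{K}[s]$, $B(s)$ is the b-function of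 $I_f$ if and only if $(-1)^{\deg B}B(-s-r)$ is the Bernstein–Sato polynomial of $f$; that is, for the b-function $B(s)$ of $I_f$, $$b_f(s)=(-1)^{\deg B(s)}\,B(-s-r).$$ -/

import Mathlib

noncomputable section

namespace BernsteinSato

/-! ### Weyl algebras, normally ordered expressions, initial ideals and global b-functions -/

section Weyl

variable (K : Type*) [Field K] (ι : Type*)

/-- The defining relations of the Weyl algebra; `Sum.inl i` is the generator `x_i` and
`Sum.inr i` is the generator `∂_i`. -/
inductive WeylRel : FreeAlgebra K (ι ⊕ ι) → FreeAlgebra K (ι ⊕ ι) → Prop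
  | x_x (i j : ι) : WeylRel
      (FreeAlgebra.ι K (Sum.inl i) * FreeAlgebra.ι K (Sum.inl j))
      (FreeAlgebra.ι K (Sum.inl j) * FreeAlgebra.ι K (Sum.inl i))
  | d_d (i j : ι) : WeylRel
      (FreeAlgebra.ι K (Sum.inr i) * FreeAlgebra.ι K (Sum.inr j))
      (FreeAlgebra.ι K (Sum.inr j) * FreeAlgebra.ι K (Sum.inr i))
  | d_x_self (i : ι) : WeylRel
      (FreeAlgebra.ι K (Sum.inr i) * FreeAlgebra.ι K (Sum.inl i))
      (FreeAlgebra.ι K (Sum.inl i) * FreeAlgebra.ι K (Sum.inr i) + 1)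
  | d_x_ne (i j : ι) (h : i ≠ j) : WeylRel
      (FreeAlgebra.ι K (Sum.inr i) * FreeAlgebra.ι K (Sum.inl j))
      (FreeAlgebra.ι K (Sum.inl j) * FreeAlgebra.ι K (Sum.inr i))

/-- The Weyl algebra over `K` in the variables `x_i`, `∂_i` (`i : ι`). -/
def WeylAlgebra : Type _ := RingQuot (WeylRel K ι)

namespace WeylAlgebra

instance : Ring (WeylAlgebra K ι) := inferInstanceAs (Ring (RingQuot (WeylRel K ι)))

instance : Algebra K (WeylAlgebra K ι) :=
  inferInstanceAs (Algebra K (RingQuot (WeylRel K ι)))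

/-- The quotient map from the free algebra. -/
def mk : FreeAlgebra K (ι ⊕ ι) →ₐ[K] WeylAlgebra K ι := RingQuot.mkAlgHom K (WeylRel K ι)

variable {ι}

/-- The generator `x_i`. -/
def x (i : ι) : WeylAlgebra K ι := mk K ι (FreeAlgebra.ι K (Sum.inl i))

/-- The generator `∂_i`. -/
def d (i : ι) : WeylAlgebra K ι := mk K ι (FreeAlgebra.ι K (Sum.inr i))

theorem mk_rel {a b : FreeAlgebra K (ι ⊕ ι)} (h : WeylRel K ι a b) : mk K ι a = mk K ι b :=
  RingQuot.mkAlgHom_rel K h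

theorem x_mul_x (i j : ι) : x K i * x K j = x K j * x K i := by
  simpa only [map_mul, x, d] using mk_rel K (WeylRel.x_x i j)

theorem d_mul_d (i j : ι) : d K i * d K j = d K j * d K i := by
  simpa only [map_mul, x, d] using mk_rel K (WeylRel.d_d i j)

theorem d_mul_x_self (i : ι) : d K i * x K i = x K i * d K i + 1 := by
  simpa only [map_mul, map_add, map_one, x, d] using mk_rel K (WeylRel.d_x_self i)

theorem d_mul_x_ne {i j : ι} (h : i ≠ j) : d K i * x K j = x K j * d K i := by
  simpa only [map_mul, x, d] using mk_rel K (WeylRel.d_x_ne i j h)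

section Lift

variable {K} {A : Type*} [Ring A] [Algebra K A]

/-- The universal property of the Weyl algebra. -/
def lift (X D : ι → A) (hXX : ∀ i j, X i * X j = X j * X i)
    (hDD : ∀ i j, D i * D j = D j * D i) (hDX : ∀ i, D i * X i = X i * D i + 1)
    (hne : ∀ i j, i ≠ j → D i * X j = X j * D i) : WeylAlgebra K ι →ₐ[K] A :=
  RingQuot.liftAlgHom K ⟨FreeAlgebra.lift K (Sum.elim X D), by
    intro a b h
    cases h with
    | x_x i j => simpa using hXX i j
    | d_d i j => simpa using hDD i j
    | d_x_self i => simpa using hDX i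
    | d_x_ne i j h => simpa using hne i j h⟩

theorem lift_x (X D : ι → A) (hXX hDD hDX hne) (i : ι) :
    lift (K := K) X D hXX hDD hDX hne (x K i) = X i := by
  unfold lift x mk
  erw [RingQuot.liftAlgHom_mkAlgHom_apply]
  simp

theorem lift_d (X D : ι → A) (hXX hDD hDX hne) (i : ι) :
    lift (K := K) X D hXX hDD hDX hne (d K i) = D i := by
  unfold lift d mk
  erw [RingQuot.liftAlgHom_mkAlgHom_apply]
  simp

theorem hom_ext {φ ψ : WeylAlgebra K ι →ₐ[K] A} (hx : ∀ i, φ (x K i) = ψ (x K i))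
    (hd : ∀ i, φ (d K i) = ψ (d K i)) : φ = ψ := by
  apply RingQuot.ringQuot_ext'
  apply FreeAlgebra.hom_ext
  funext i
  cases i with
  | inl i => exact hx i
  | inr i => exact hd i

end Lift

variable [Fintype ι]

/-- The commutative monomial `x^α`. -/
def xPow (α : ι →₀ ℕ) : WeylAlgebra K ι :=
  Finset.univ.noncommProd (fun i => x K i ^ α i)
    (fun i _ j _ _ => Commute.pow_pow (x_mul_x K i j) _ _)

/-- The commutative monomial `∂^β`. -/
def dPow (β : ι →₀ ℕ) : WeylAlgebra K ι :=
  Finset.univ.noncommProd (fun i => d K i ^ β i)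
    (fun i _ j _ _ => Commute.pow_pow (d_mul_d K i j) _ _)

variable {K}

/-- The inclusion of `K[x]` in the Weyl algebra. -/
def ofPoly (p : MvPolynomial ι K) : WeylAlgebra K ι :=
  ∑ α ∈ p.support, p.coeff α • xPow K α

/-- The operator `∑ c_{αβ} x^α ∂^β` with the finite family of coefficients `c`. -/
def ofCoeff (c : ((ι →₀ ℕ) × (ι →₀ ℕ)) →₀ K) : WeylAlgebra K ι :=
  c.sum fun m a => a • (xPow K m.1 * dPow K m.2)

/-- The weight `-w·α + w·β` of the monomial `x^α ∂^β`. -/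
def weight (w : ι → ℕ) (m : (ι →₀ ℕ) × (ι →₀ ℕ)) : ℤ :=
  ∑ i, (w i : ℤ) * ((m.2 i : ℤ) - (m.1 i : ℤ))

open Classical in
/-- The coefficients of the monomials of maximal weight among those that occur in `c`. -/
def initialCoeff (w : ι → ℕ) (c : ((ι →₀ ℕ) × (ι →₀ ℕ)) →₀ K) :
    ((ι →₀ ℕ) × (ι →₀ ℕ)) →₀ K :=
  c.filter fun m => ∀ m' ∈ c.support, weight w m' ≤ weight w m

/-- The initial ideal `in_{(-w,w)}(I)`: the `K`-span of the initial forms of the elements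
`∑ c_{αβ} x^α ∂^β` of `I`. -/
def initialIdeal (w : ι → ℕ) (I : Ideal (WeylAlgebra K ι)) : Submodule K (WeylAlgebra K ι) :=
  Submodule.span K {Q | ∃ c : ((ι →₀ ℕ) × (ι →₀ ℕ)) →₀ K,
    ofCoeff c ∈ I ∧ Q = ofCoeff (initialCoeff w c)}

variable (K) in
/-- The weighted Euler operator `∑ w_i x_i ∂_i`. -/
def euler (w : ι → ℕ) : WeylAlgebra K ι := ∑ i, w i • (x K i * d K i)

/-- `B` is the monic generator of the ideal `in_{(-w,w)}(I) ∩ K[θ]` of `K[θ]`, where `θ` is the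
weighted Euler operator and `K[θ]` is identified with a polynomial ring in one variable. -/
def IsGlobalBFunction (w : ι → ℕ) (I : Ideal (WeylAlgebra K ι)) (B : Polynomial K) : Prop :=
  B.Monic ∧ ∀ p : Polynomial K, Polynomial.aeval (euler K w) p ∈ initialIdeal w I ↔ B ∣ p

open Classical in
/-- The global b-function of the left ideal `I` with respect to the weight `w`, that is, the
monic generator of `in_{(-w,w)}(I) ∩ K[θ]` (zero if that intersection is zero). -/
def globalBFunction (w : ι → ℕ) (I : Ideal (WeylAlgebra K ι)) : Polynomial K :=
  if h : ∃ B, IsGlobalBFunction w I B then h.choose else 0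

end WeylAlgebra

end Weyl

/-! ### The Malgrange ideal -/

section Malgrange

variable {K : Type*} [Field K] {n r : ℕ}

open WeylAlgebra

/-- A polynomial in the variables `x`, regarded as an element of `D_n⟨t, ∂t⟩`. The variables `x_m`
have the indices `Sum.inl m`, the variables `t_j` have the indices `Sum.inr j`. -/
def polyXT (r : ℕ) (p : MvPolynomial (Fin n) K) : WeylAlgebra K (Fin n ⊕ Fin r) :=
  ofPoly (MvPolynomial.rename Sum.inl p)

/-- The Malgrange ideal of `f = (f_1, …, f_r)`, the left ideal of `D_n⟨t, ∂t⟩` generated by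
`t_i - f_i` and `∂_m + ∑ j, (∂f_j/∂x_m) ∂t_j`. -/
def malgrangeIdeal (f : Fin r → MvPolynomial (Fin n) K) :
    Ideal (WeylAlgebra K (Fin n ⊕ Fin r)) :=
  Ideal.span
    (Set.range (fun i : Fin r => x K (Sum.inr i) - polyXT r (f i)) ∪
      Set.range (fun m : Fin n => d K (Sum.inl m) +
        ∑ j : Fin r, polyXT r (MvPolynomial.pderiv m (f j)) * d K (Sum.inr j)))

/-- The weight vector giving `∂_m` weight `0` and `∂t_j` weight `1`. -/
def weightT (n r : ℕ) : Fin n ⊕ Fin r → ℕ := Sum.elim (fun _ => 0) (fun _ => 1)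

end Malgrange

/-! ### Extending a derivation to a localization -/

section LocalizedDerivation

variable {K : Type*} [Field K] {P : Type*} [CommRing P] [Algebra K P]

theorem derivation_localization_ext (g : P)
    (D₁ D₂ : Derivation K (Localization.Away g) (Localization.Away g))
    (h : ∀ p : P, D₁ (algebraMap P _ p) = D₂ (algebraMap P _ p)) : D₁ = D₂ := by
  ext a
  obtain ⟨⟨p, q⟩, hq⟩ := IsLocalization.surj (Submonoid.powers g) a
  have hu : IsUnit (algebraMap P (Localization.Away g) q) := IsLocalization.map_units _ q
  have h1 := congrArg D₁ hq
  have h2 := congrArg D₂ hq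
  simp only [Derivation.leibniz, smul_eq_mul, h] at h1 h2
  apply hu.mul_left_cancel
  linear_combination h1 - h2

theorem exists_localizedDerivation (g : P) (d : Derivation K P P) :
    ∃ D : Derivation K (Localization.Away g) (Localization.Away g),
      ∀ p : P, D (algebraMap P _ p) = algebraMap P _ (d p) := by
  let A := Localization.Away g
  let φ : P →+* TrivSqZeroExt A A :=
    { toFun := fun p => TrivSqZeroExt.inl (algebraMap P A p) + TrivSqZeroExt.inr (algebraMap P A (d p))
      map_one' := by ext <;> simp
      map_mul' := fun a b => by
        ext
        · simp only [map_mul, TrivSqZeroExt.fst_add, TrivSqZeroExt.fst_mul,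
            TrivSqZeroExt.fst_inl, TrivSqZeroExt.fst_inr, add_zero]
        · simp only [Derivation.leibniz, smul_eq_mul, map_add, map_mul, TrivSqZeroExt.snd_add,
            TrivSqZeroExt.snd_inl, TrivSqZeroExt.snd_inr, TrivSqZeroExt.snd_mul,
            TrivSqZeroExt.fst_add, TrivSqZeroExt.fst_inl, TrivSqZeroExt.fst_inr,
            MulOpposite.smul_eq_mul_unop, MulOpposite.unop_op]
          ring
      map_zero' := by ext <;> simp
      map_add' := fun a b => by
        ext
        · simp only [map_add, TrivSqZeroExt.fst_add, TrivSqZeroExt.fst_inl, TrivSqZeroExt.fst_inr, add_zero]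
        · simp only [map_add, TrivSqZeroExt.snd_add, TrivSqZeroExt.snd_inl,
            TrivSqZeroExt.snd_inr]
          ring }
  have hφ : ∀ y : Submonoid.powers g, IsUnit (φ y) := fun y => by
    rw [TrivSqZeroExt.isUnit_iff_isUnit_fst]
    simpa [φ] using IsLocalization.map_units A y
  let ψ : A →+* TrivSqZeroExt A A := IsLocalization.lift hφ
  have hψ : ∀ p, ψ (algebraMap P A p) = φ p := fun p => IsLocalization.lift_eq hφ p
  have hfst : ∀ a, (ψ a).fst = a := by
    have : (TrivSqZeroExt.fstHom A A A).toRingHom.comp ψ = RingHom.id A := by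
      apply IsLocalization.ringHom_ext (Submonoid.powers g)
      ext p
      simp [hψ, φ]
    exact fun a => RingHom.congr_fun this a
  have hD : ∀ p : P, (ψ (algebraMap P A p)).snd = algebraMap P A (d p) := fun p => by
    rw [hψ]; simp [φ]
  have hmul : ∀ a b : A, (ψ (a * b)).snd = a * (ψ b).snd + b * (ψ a).snd := fun a b => by
    rw [map_mul, TrivSqZeroExt.snd_mul, hfst, hfst]; simp [mul_comm]
  refine ⟨Derivation.mk'
    { toFun := fun a => (ψ a).snd
      map_add' := fun a b => by simp
      map_smul' := fun c a => ?_ } ?_, fun p => ?_⟩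
  · rw [Algebra.smul_def, hmul, IsScalarTower.algebraMap_apply K P A, hD]
    simp [Algebra.smul_def, IsScalarTower.algebraMap_apply K P (Localization.Away g), A]
  · intro a b
    exact hmul a b
  · exact hD p

/-- The unique extension of a derivation of `P` to the localization `P[1/g]`. -/
def localizedDerivation (g : P) (d : Derivation K P P) :
    Derivation K (Localization.Away g) (Localization.Away g) :=
  (exists_localizedDerivation g d).choose

theorem localizedDerivation_algebraMap (g : P) (d : Derivation K P P) (p : P) :
    localizedDerivation g d (algebraMap P _ p) = algebraMap P _ (d p) :=
  (exists_localizedDerivation g d).choose_spec p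

end LocalizedDerivation

/-! ### The module `M = K[x, s, 1/f] · f^s` -/

section Module

variable {K : Type*} [Field K] {n r : ℕ}

/-- The polynomial ring `K[x, s]`; `x_m` has the index `Sum.inl m`, `s_i` the index `Sum.inr i`. -/
abbrev PolyXS (K : Type*) [Field K] (n r : ℕ) : Type _ := MvPolynomial (Fin n ⊕ Fin r) K

/-- The inclusion of `K[x]` in `K[x, s]`. -/
def inclX (r : ℕ) : MvPolynomial (Fin n) K →ₐ[K] PolyXS K n r := MvPolynomial.rename Sum.inl

/-- The product `f_1 ⋯ f_r` in `K[x, s]`. -/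
def prodF (f : Fin r → MvPolynomial (Fin n) K) : PolyXS K n r := ∏ i, inclX r (f i)

/-- The free `K[x, s, 1/f]`-module of rank one generated by the symbol `f^s`, where
`1/f = 1/(f_1 ⋯ f_r)`. The element `G(s) · f^s` is represented by its coefficient `G(s)`, an
element of the localization `K[x, s, 1/f]`. -/
def ModuleFs (f : Fin r → MvPolynomial (Fin n) K) : Type _ := Localization.Away (prodF f)

instance (f : Fin r → MvPolynomial (Fin n) K) : CommRing (ModuleFs f) :=
  inferInstanceAs (CommRing (Localization.Away (prodF f)))

instance (f : Fin r → MvPolynomial (Fin n) K) : Algebra K (ModuleFs f) :=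
  inferInstanceAs (Algebra K (Localization.Away (prodF f)))

instance (f : Fin r → MvPolynomial (Fin n) K) : Algebra (PolyXS K n r) (ModuleFs f) :=
  inferInstanceAs (Algebra (PolyXS K n r) (Localization.Away (prodF f)))

instance (f : Fin r → MvPolynomial (Fin n) K) :
    IsScalarTower K (PolyXS K n r) (ModuleFs f) :=
  inferInstanceAs (IsScalarTower K (PolyXS K n r) (Localization.Away (prodF f)))

instance (f : Fin r → MvPolynomial (Fin n) K) :
    IsLocalization.Away (prodF f) (ModuleFs f) :=
  inferInstanceAs (IsLocalization.Away (prodF f) (Localization.Away (prodF f)))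

variable (f : Fin r → MvPolynomial (Fin n) K)

/-- The generator `f^s`. -/
def genFs : ModuleFs f := 1

/-- An element of `K[x, s]` as an element of `K[x, s, 1/f]`. -/
def coef : PolyXS K n r →ₐ[K] ModuleFs f := IsScalarTower.toAlgHom K (PolyXS K n r) (ModuleFs f)

/-- `f_i` as an element of `K[x, s, 1/f]`. -/
def fElt (i : Fin r) : ModuleFs f := coef f (inclX r (f i))

/-- `1/f_i` as an element of `K[x, s, 1/f]`. -/
def fInv (i : Fin r) : ModuleFs f :=
  (∏ j ∈ Finset.univ.erase i, fElt f j) * IsLocalization.Away.invSelf (prodF f)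

/-- `s_i` as an element of `K[x, s, 1/f]`. -/
def sElt (i : Fin r) : ModuleFs f := coef f (MvPolynomial.X (Sum.inr i))

/-- `x_m` as an element of `K[x, s, 1/f]`. -/
def xElt (m : Fin n) : ModuleFs f := coef f (MvPolynomial.X (Sum.inl m))

/-- The derivation `∂/∂x_m` of `K[x, s, 1/f]`. -/
def partialX (m : Fin n) : Derivation K (ModuleFs f) (ModuleFs f) :=
  localizedDerivation (prodF f) (MvPolynomial.pderiv (Sum.inl m))

/-- The substitution `s ↦ s + a` on `K[x, s]`. -/
def shiftPoly (n : ℕ) (a : Fin r → K) : PolyXS K n r →ₐ[K] PolyXS K n r :=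
  MvPolynomial.aeval (Sum.elim (fun m => MvPolynomial.X (Sum.inl m))
    (fun i => MvPolynomial.X (Sum.inr i) + MvPolynomial.C (a i)))

theorem shiftPoly_inclX (a : Fin r → K) (p : MvPolynomial (Fin n) K) :
    shiftPoly n a (inclX r p) = inclX r p := by
  have : (shiftPoly n a).comp (inclX r) = inclX r := by
    apply MvPolynomial.algHom_ext
    intro m
    simp [shiftPoly, inclX]
  exact DFunLike.congr_fun this p

theorem isUnit_coef_shiftPoly (a : Fin r → K) (y : Submonoid.powers (prodF f)) :
    IsUnit ((coef f).comp (shiftPoly n a) (y : PolyXS K n r)) := by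
  obtain ⟨_, k, rfl⟩ := y
  have h : IsUnit (coef f (prodF f)) := IsLocalization.Away.algebraMap_isUnit (prodF f)
  have h2 : shiftPoly n a (prodF f) = prodF f := by
    simp [prodF, map_prod, shiftPoly_inclX]
  simp only [AlgHom.comp_apply, map_pow, h2]
  exact h.pow k

/-- The substitution `G(s) ↦ G(s + a)` on `K[x, s, 1/f]`. -/
def shift (a : Fin r → K) : ModuleFs f →ₐ[K] ModuleFs f :=
  IsLocalization.liftAlgHom (M := Submonoid.powers (prodF f)) (isUnit_coef_shiftPoly f a)

theorem shift_coef (a : Fin r → K) (p : PolyXS K n r) :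
    shift f a (coef f p) = coef f (shiftPoly n a p) :=
  IsLocalization.lift_eq (isUnit_coef_shiftPoly f a) p

/-- The operator of multiplication by `x_m` on `M`. -/
def xOp (m : Fin n) : Module.End K (ModuleFs f) := LinearMap.mulLeft K (xElt f m)

/-- The logarithmic derivative `∑ i, s_i (∂f_i/∂x_m) / f_i` of `f^s`. -/
def logDer (m : Fin n) : ModuleFs f :=
  ∑ i, sElt f i * coef f (inclX r (MvPolynomial.pderiv m (f i))) * fInv f i

/-- The operator `∂_m` on `M`:
`∂_m • (G f^s) = (∂G/∂x_m + G ∑ i, s_i (∂f_i/∂x_m) / f_i) f^s`. -/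
def dOp (m : Fin n) : Module.End K (ModuleFs f) :=
  (partialX f m).toLinearMap + LinearMap.mulLeft K (logDer f m)

/-- The vector `ε_j - ε_i`. -/
def epsSub (K : Type*) [Field K] {r : ℕ} (j i : Fin r) : Fin r → K :=
  Pi.single j 1 - Pi.single i 1

/-- The operator `s_ij` on `M`: `s_ij • (G(s) f^s) = s_i G(s + ε_j - ε_i) (f_j / f_i) f^s`. -/
def sOp (i j : Fin r) : Module.End K (ModuleFs f) :=
  LinearMap.mulLeft K (sElt f i * fElt f j * fInv f i) ∘ₗ (shift f (epsSub K j i)).toLinearMap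

theorem fElt_mul_fInv (i : Fin r) : fElt f i * fInv f i = 1 := by
  unfold fInv
  rw [← mul_assoc, Finset.mul_prod_erase Finset.univ (fElt f) (Finset.mem_univ i)]
  have : ∏ j, fElt f j = algebraMap _ (ModuleFs f) (prodF f) := by
    change _ = coef f (prodF f)
    simp [prodF, fElt, map_prod]
  rw [this]
  exact IsLocalization.Away.mul_invSelf (prodF f)

theorem partialX_coef (m : Fin n) (p : PolyXS K n r) :
    partialX f m (coef f p) = coef f (MvPolynomial.pderiv (Sum.inl m) p) :=
  localizedDerivation_algebraMap _ _ p

theorem partialX_xElt (m l : Fin n) : partialX f m (xElt f l) = if m = l then 1 else 0 := by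
  rw [xElt, partialX_coef, MvPolynomial.pderiv_X]
  by_cases h : m = l
  · subst h; simp
  · have : (Sum.inl m : Fin n ⊕ Fin r) ≠ Sum.inl l := by simpa using h
    simp [h, eq_comm]

theorem partialX_sElt (m : Fin n) (i : Fin r) : partialX f m (sElt f i) = 0 := by
  rw [sElt, partialX_coef, MvPolynomial.pderiv_X]
  simp

theorem pderiv_inclX (m : Fin n) (p : MvPolynomial (Fin n) K) :
    MvPolynomial.pderiv (Sum.inl m) (inclX r p) = inclX r (MvPolynomial.pderiv m p) := by
  exact MvPolynomial.pderiv_rename Sum.inl_injective m p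

theorem partialX_fElt (m : Fin n) (i : Fin r) :
    partialX f m (fElt f i) = coef f (inclX r (MvPolynomial.pderiv m (f i))) := by
  rw [fElt, partialX_coef, pderiv_inclX]

theorem partialX_fInv (m : Fin n) (i : Fin r) :
    partialX f m (fInv f i) = - (fInv f i * fInv f i * partialX f m (fElt f i)) := by
  have h := fElt_mul_fInv f i
  have h1 := congrArg (partialX f m) h
  rw [Derivation.leibniz, Derivation.map_one_eq_zero, smul_eq_mul, smul_eq_mul] at h1
  linear_combination (fInv f i) * h1 - (partialX f m (fInv f i)) * h

theorem partialX_comm (l m : Fin n) (a : ModuleFs f) :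
    partialX f l (partialX f m a) = partialX f m (partialX f l a) := by
  have h : ⁅partialX f l, partialX f m⁆ = 0 := by
    apply derivation_localization_ext
    intro p
    change ⁅partialX f l, partialX f m⁆ (coef f p) = 0
    rw [Derivation.commutator_apply]
    simp only [partialX_coef]
    rw [sub_eq_zero]
    refine congrArg (coef f) ?_
    have h0 : ⁅(MvPolynomial.pderiv (Sum.inl l) : Derivation K (PolyXS K n r) (PolyXS K n r)),
        (MvPolynomial.pderiv (Sum.inl m) : Derivation K (PolyXS K n r) (PolyXS K n r))⁆ = 0 := by
      refine MvPolynomial.derivation_ext (R := K) (A := PolyXS K n r) fun i => ?_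
      rw [Derivation.commutator_apply]
      simp [MvPolynomial.pderiv_X, Pi.single_apply, apply_ite]
    have h1 := DFunLike.congr_fun h0 p
    rwa [Derivation.commutator_apply, Derivation.zero_apply, sub_eq_zero] at h1
  have h1 := DFunLike.congr_fun h a
  rwa [Derivation.commutator_apply, Derivation.zero_apply, sub_eq_zero] at h1

theorem shift_sElt (a : Fin r → K) (i : Fin r) :
    shift f a (sElt f i) = sElt f i + algebraMap K _ (a i) := by
  rw [sElt, shift_coef]
  simp only [shiftPoly, MvPolynomial.aeval_X, Sum.elim_inr, map_add]
  rw [← MvPolynomial.algebraMap_eq, AlgHom.commutes]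

theorem shift_coef_inclX (a : Fin r → K) (p : MvPolynomial (Fin n) K) :
    shift f a (coef f (inclX r p)) = coef f (inclX r p) := by
  rw [shift_coef, shiftPoly_inclX]

theorem shift_fElt (a : Fin r → K) (i : Fin r) : shift f a (fElt f i) = fElt f i := by
  exact shift_coef_inclX f a (f i)

theorem shift_fInv (a : Fin r → K) (i : Fin r) : shift f a (fInv f i) = fInv f i := by
  have h := fElt_mul_fInv f i
  have h1 := congrArg (shift f a) h
  rw [map_mul, map_one, shift_fElt] at h1
  linear_combination (fInv f i) * h1 - (shift f a (fInv f i)) * h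

theorem shift_shift (a b : Fin r → K) (G : ModuleFs f) :
    shift f a (shift f b G) = shift f (a + b) G := by
  have h : ((shift f a).comp (shift f b)).toRingHom = (shift f (a + b)).toRingHom := by
    apply IsLocalization.ringHom_ext (Submonoid.powers (prodF f))
    apply RingHom.ext
    intro p
    change shift f a (shift f b (coef f p)) = shift f (a + b) (coef f p)
    rw [shift_coef, shift_coef, shift_coef]
    refine congrArg (coef f) ?_
    have h0 : (shiftPoly n a).comp (shiftPoly n b) = shiftPoly (K := K) n (a + b) := by
      apply MvPolynomial.algHom_ext
      rintro (m | i)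
      · simp [shiftPoly]
      · simp [shiftPoly]
        ring
    exact DFunLike.congr_fun h0 p
  exact RingHom.congr_fun h G

theorem partialX_shift (m : Fin n) (a : Fin r → K) (G : ModuleFs f) :
    partialX f m (shift f a G) = shift f a (partialX f m G) := by
  obtain ⟨⟨p, q⟩, hq⟩ := IsLocalization.surj (Submonoid.powers (prodF f)) G
  have hpoly : ∀ p : PolyXS K n r, partialX f m (shift f a (coef f p)) =
      shift f a (partialX f m (coef f p)) := by
    intro p
    rw [shift_coef, partialX_coef, partialX_coef, shift_coef]
    refine congrArg (coef f) ?_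
    induction p using MvPolynomial.induction_on with
    | C c => simp [shiftPoly]
    | add p q hp hq => simp [hp, hq]
    | mul_X p i hp =>
      have hX : MvPolynomial.pderiv (Sum.inl m) (shiftPoly n a (MvPolynomial.X i)) =
          shiftPoly n a (MvPolynomial.pderiv (Sum.inl m) (MvPolynomial.X i)) := by
        rcases i with l | i
        · simp [shiftPoly, MvPolynomial.pderiv_X, Pi.single_apply, apply_ite]
        · simp [shiftPoly, MvPolynomial.pderiv_X]
      simp only [map_mul, Derivation.leibniz, smul_eq_mul, map_add, hp, hX]
  have hq' : G * coef f (q : PolyXS K n r) = coef f p := hq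
  have h1 := congrArg (fun z => partialX f m (shift f a z)) hq'
  have h2 := congrArg (fun z => shift f a (partialX f m z)) hq'
  simp only [map_mul, Derivation.leibniz, smul_eq_mul, map_add, hpoly] at h1 h2
  have hu : IsUnit (shift f a (coef f (q : PolyXS K n r))) :=
    (IsLocalization.map_units (ModuleFs f) q).map (shift f a)
  apply hu.mul_left_cancel
  linear_combination h1 - h2

theorem sOp_apply (i j : Fin r) (G : ModuleFs f) :
    sOp f i j G = sElt f i * fElt f j * fInv f i * shift f (epsSub K j i) G := rfl

theorem dOp_apply (m : Fin n) (G : ModuleFs f) :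
    dOp f m G = partialX f m G + logDer f m * G := rfl

theorem xOp_apply (m : Fin n) (G : ModuleFs f) : xOp f m G = xElt f m * G := rfl

theorem xOp_mul_xOp (l m : Fin n) : xOp f l * xOp f m = xOp f m * xOp f l := by
  ext G
  simp only [Module.End.mul_apply, xOp_apply]
  ring

theorem dOp_mul_dOp (l m : Fin n) : dOp f l * dOp f m = dOp f m * dOp f l := by
  have hL : partialX f l (logDer f m) = partialX f m (logDer f l) := by
    simp only [logDer, map_sum]
    refine Finset.sum_congr rfl fun i _ => ?_
    simp only [← partialX_fElt, Derivation.leibniz, smul_eq_mul, partialX_sElt, partialX_fInv]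
    rw [partialX_comm f l m]
    ring
  ext G
  simp only [Module.End.mul_apply, dOp_apply, map_add, Derivation.leibniz, smul_eq_mul, hL]
  rw [partialX_comm f l m]
  ring

theorem dOp_mul_xOp_self (m : Fin n) : dOp f m * xOp f m = xOp f m * dOp f m + 1 := by
  ext G
  simp only [Module.End.mul_apply, LinearMap.add_apply, Module.End.one_apply, dOp_apply, xOp_apply,
    Derivation.leibniz, smul_eq_mul, partialX_xElt, if_true]
  ring

theorem dOp_mul_xOp_ne (l m : Fin n) (h : l ≠ m) : dOp f l * xOp f m = xOp f m * dOp f l := by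
  ext G
  simp only [Module.End.mul_apply, dOp_apply, xOp_apply,
    Derivation.leibniz, smul_eq_mul, partialX_xElt, if_neg h]
  ring

theorem xOp_mul_sOp (m : Fin n) (i j : Fin r) : xOp f m * sOp f i j = sOp f i j * xOp f m := by
  ext G
  have hx : shift f (epsSub K j i) (xElt f m) = xElt f m := by
    rw [xElt, shift_coef]; simp [shiftPoly]
  simp only [Module.End.mul_apply, xOp_apply, sOp_apply, map_mul, hx]
  ring

theorem dOp_mul_sOp (m : Fin n) (i j : Fin r) : dOp f m * sOp f i j = sOp f i j * dOp f m := by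
  have hL : shift f (epsSub K j i) (logDer f m) = logDer f m +
      partialX f m (fElt f j) * fInv f j - partialX f m (fElt f i) * fInv f i := by
    simp only [logDer, map_sum, map_mul, shift_coef_inclX, shift_fInv, shift_sElt, add_mul,
      Finset.sum_add_distrib, partialX_fElt, add_sub_assoc]
    congr 1
    simp only [epsSub, Pi.sub_apply, Pi.single_apply, map_sub, apply_ite (algebraMap K _), map_one,
      map_zero, sub_mul, Finset.sum_sub_distrib, ite_mul, one_mul, zero_mul, Finset.sum_ite_eq',
      Finset.mem_univ, if_true]
  ext G
  simp only [Module.End.mul_apply, dOp_apply, sOp_apply, map_mul, map_add, hL,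
    Derivation.leibniz, smul_eq_mul, partialX_sElt, partialX_fInv, partialX_shift]
  linear_combination (sElt f i * fInv f i * shift f (epsSub K j i) G * partialX f m (fElt f j)) *
    (- fElt_mul_fInv f j)

theorem sOp_bracket (i j k l : Fin r) :
    sOp f i j * sOp f k l - sOp f k l * sOp f i j =
      (if j = k then sOp f i l else 0) - (if l = i then sOp f k j else 0) := by
  ext G
  have e1 : epsSub K j i + epsSub K l k = epsSub K l k + epsSub K j i := add_comm _ _
  simp only [LinearMap.sub_apply, Module.End.mul_apply, sOp_apply, map_mul, shift_sElt,
    shift_fElt, shift_fInv, shift_shift, e1]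
  have h1 : (if j = k then sOp f i l else 0) G =
      if j = k then sElt f i * fElt f l * fInv f i * fElt f j * fInv f k *
        shift f (epsSub K l k + epsSub K j i) G else 0 := by
    by_cases h : j = k
    · subst h
      have : epsSub K l j + epsSub K j i = epsSub K l i := by simp [epsSub]
      rw [if_pos rfl, if_pos rfl, this, sOp_apply]
      linear_combination (-(sElt f i * fElt f l * fInv f i * shift f (epsSub K l i) G)) *
        fElt_mul_fInv f j
    · simp [h]
  have h2 : (if l = i then sOp f k j else 0) G =
      if l = i then sElt f k * fElt f j * fInv f k * fElt f l * fInv f i *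
        shift f (epsSub K l k + epsSub K j i) G else 0 := by
    by_cases h : l = i
    · subst h
      have : epsSub K l k + epsSub K j l = epsSub K j k := by simp [epsSub]
      rw [if_pos rfl, if_pos rfl, this, sOp_apply]
      linear_combination (-(sElt f k * fElt f j * fInv f k * shift f (epsSub K j k) G)) *
        fElt_mul_fInv f l
    · simp [h]
  rw [h1, h2]
  have c1 : algebraMap K (ModuleFs f) (epsSub K j i k) =
      (if j = k then 1 else 0) - (if i = k then 1 else 0) := by
    simp only [epsSub, Pi.sub_apply, Pi.single_apply, map_sub, apply_ite (algebraMap K _), map_one,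
      map_zero, @eq_comm _ k]
  have c2 : algebraMap K (ModuleFs f) (epsSub K l k i) =
      (if l = i then 1 else 0) - (if i = k then 1 else 0) := by
    simp only [epsSub, Pi.sub_apply, Pi.single_apply, map_sub, apply_ite (algebraMap K _), map_one,
      map_zero, @eq_comm _ i]
  rw [c1, c2]
  by_cases hik : i = k
  · subst hik
    split_ifs <;> ring
  · simp only [if_neg hik]
    split_ifs <;> ring

/-- The action of the Weyl algebra `D_n` on `M`. -/
def actD : WeylAlgebra K (Fin n) →ₐ[K] Module.End K (ModuleFs f) :=
  WeylAlgebra.lift (xOp f) (dOp f) (xOp_mul_xOp f) (dOp_mul_dOp f) (dOp_mul_xOp_self f)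
    (dOp_mul_xOp_ne f)

attribute [local instance] LieRing.ofAssociativeRing

/-- The Lie algebra `gl_r`. Its matrix units `E_ij` satisfy
`[E_ij, E_kl] = δ_jk E_il - δ_il E_kj`. -/
abbrev Glr (K : Type*) [Field K] (r : ℕ) : Type _ := Matrix (Fin r) (Fin r) K

/-- The linear map `gl_r → End(M)` with `E_ij ↦ s_ij`. -/
def actGLLin : Glr K r →ₗ[K] Module.End K (ModuleFs f) where
  toFun A := ∑ i, ∑ j, A i j • sOp f i j
  map_add' A B := by simp [add_smul, Finset.sum_add_distrib]
  map_smul' c A := by simp [mul_smul, Finset.smul_sum]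

theorem actGLLin_single (i j : Fin r) : actGLLin f (Matrix.single i j 1) = sOp f i j := by
  change ∑ i', ∑ j', Matrix.single i j (1 : K) i' j' • sOp f i' j' = _
  rw [Finset.sum_eq_single i, Finset.sum_eq_single j]
  · simp
  · intro b _ hb
    simp [hb.symm]
  · simp
  · intro b _ hb
    simp [hb.symm]
  · simp

theorem actGLLin_lie (A B : Glr K r) :
    actGLLin f ⁅A, B⁆ = ⁅actGLLin f A, actGLLin f B⁆ := by
  have hs : ∀ i j k l : Fin r, actGLLin f ⁅Matrix.single i j (1 : K), Matrix.single k l (1 : K)⁆ =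
      ⁅sOp f i j, sOp f k l⁆ := by
    intro i j k l
    rw [Ring.lie_def, Ring.lie_def, sOp_bracket, map_sub]
    congr 1
    · by_cases h : j = k
      · subst h
        rw [Matrix.single_mul_single_same, if_pos rfl, mul_one, actGLLin_single]
      · rw [Matrix.single_mul_single_of_ne (h := h), if_neg h, map_zero]
    · by_cases h : l = i
      · subst h
        rw [Matrix.single_mul_single_same, if_pos rfl, mul_one, actGLLin_single]
      · rw [Matrix.single_mul_single_of_ne (h := h), if_neg h, map_zero]
  have hA : ∀ C : Glr K r, C = ∑ i, ∑ j, C i j • Matrix.single i j (1 : K) := by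
    intro C
    conv_lhs => rw [Matrix.matrix_eq_sum_single C]
    simp [Matrix.smul_single]
  rw [hA A, hA B]
  simp only [sum_lie, lie_sum, smul_lie, lie_smul, map_sum, map_smul, hs, actGLLin_single,
    Finset.smul_sum]
  refine Finset.sum_congr rfl fun k _ => Finset.sum_congr rfl fun l _ =>
    Finset.sum_congr rfl fun i _ => Finset.sum_congr rfl fun j _ => ?_
  simp only [Ring.lie_def, mul_smul_comm, smul_mul_assoc, smul_sub, smul_comm (B k l)]

/-- The representation of `gl_r` on `M` with `E_ij ↦ s_ij`. -/
def actGL : Glr K r →ₗ⁅K⁆ Module.End K (ModuleFs f) :=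
  { actGLLin f with map_lie' := fun {A B} => actGLLin_lie f A B }

/-- The algebra `K⟨S⟩ = U(gl_r)`. -/
abbrev AlgS (K : Type*) [Field K] (r : ℕ) : Type _ := UniversalEnvelopingAlgebra K (Glr K r)

/-- The action of `U(gl_r)` on `M`. -/
def actS : AlgS K r →ₐ[K] Module.End K (ModuleFs f) :=
  UniversalEnvelopingAlgebra.lift K (actGL f)

theorem actD_commute_actS (P : WeylAlgebra K (Fin n)) (Q : AlgS K r) :
    Commute (actD f P) (actS f Q) := by
  have hgen : ∀ (T : Module.End K (ModuleFs f)), (∀ m, Commute (xOp f m) T) →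
      (∀ m, Commute (dOp f m) T) → ∀ P, Commute (actD f P) T := by
    intro T hx hd P
    let S : Subalgebra K (Module.End K (ModuleFs f)) := Subalgebra.centralizer K {T}
    have mem : ∀ U : Module.End K (ModuleFs f), Commute U T → U ∈ S := by
      intro U hU
      rw [Subalgebra.mem_centralizer_iff]
      rintro _ rfl
      exact hU.symm
    let ψ : WeylAlgebra K (Fin n) →ₐ[K] S :=
      WeylAlgebra.lift (fun m => ⟨xOp f m, mem _ (hx m)⟩) (fun m => ⟨dOp f m, mem _ (hd m)⟩)
        (fun i j => Subtype.ext (xOp_mul_xOp f i j)) (fun i j => Subtype.ext (dOp_mul_dOp f i j))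
        (fun i => Subtype.ext (dOp_mul_xOp_self f i))
        (fun i j h => Subtype.ext (dOp_mul_xOp_ne f i j h))
    have h : S.val.comp ψ = actD f := by
      apply WeylAlgebra.hom_ext
      · intro i
        simp only [AlgHom.comp_apply, ψ, actD, WeylAlgebra.lift_x, Subalgebra.coe_val]
      · intro i
        simp only [AlgHom.comp_apply, ψ, actD, WeylAlgebra.lift_d, Subalgebra.coe_val]
    rw [← h]
    exact ((Subalgebra.mem_centralizer_iff K).1 (ψ P).2 T rfl).symm
  have hGL : ∀ A : Glr K r, Commute (actD f P) (actGL f A) := by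
    intro A
    change Commute (actD f P) (∑ i, ∑ j, A i j • sOp f i j)
    refine Commute.sum_right _ _ _ fun i _ => Commute.sum_right _ _ _ fun j _ => ?_
    exact (hgen _ (fun m => xOp_mul_sOp f m i j) (fun m => dOp_mul_sOp f m i j) P).smul_right _
  let S : Subalgebra K (Module.End K (ModuleFs f)) := Subalgebra.centralizer K {actD f P}
  have mem : ∀ A : Glr K r, actGL f A ∈ S := by
    intro A
    rw [Subalgebra.mem_centralizer_iff]
    rintro _ rfl
    exact hGL A
  let g : Glr K r →ₗ⁅K⁆ S :=
    { toFun := fun A => ⟨actGL f A, mem A⟩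
      map_add' := fun A B => Subtype.ext (map_add _ A B)
      map_smul' := fun c A => Subtype.ext (map_smul _ c A)
      map_lie' := fun {A B} => Subtype.ext (LieHom.map_lie _ A B) }
  have h : S.val.comp (UniversalEnvelopingAlgebra.lift K g) = actS f := by
    apply UniversalEnvelopingAlgebra.hom_ext
    ext A
    simp [actS, g]
  rw [← h]
  exact (Subalgebra.mem_centralizer_iff K).1 (UniversalEnvelopingAlgebra.lift K g Q).2 _ rfl

/-- The algebra `D_n⟨S⟩ = D_n ⊗ U(gl_r)`. -/
abbrev AlgDS (K : Type*) [Field K] (n r : ℕ) : Type _ :=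
  TensorProduct K (WeylAlgebra K (Fin n)) (AlgS K r)

/-- The action of `D_n⟨S⟩` on `M`. -/
def actDS : AlgDS K n r →ₐ[K] Module.End K (ModuleFs f) :=
  Algebra.TensorProduct.lift (actD f) (actS f) (actD_commute_actS f)

/-- The polynomial `f_k`, as an element of `D_n ⊆ D_n⟨S⟩`. -/
def polyDS (r : ℕ) (p : MvPolynomial (Fin n) K) : AlgDS K n r :=
  TensorProduct.tmul K (WeylAlgebra.ofPoly p) 1

/-- The element `b(s_1 + ⋯ + s_r) · f^s` of `M`. -/
def evalSum (b : Polynomial K) : ModuleFs f := Polynomial.aeval (∑ i, sElt f i) b * genFs f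

/-- The functional equation `∑ k, P_k(S) f_k • f^s = b(s_1 + ⋯ + s_r) · f^s` in `M`, for some
`P_1(S), …, P_r(S)` in `D_n⟨S⟩`. -/
def FunctionalEquation (b : Polynomial K) : Prop :=
  ∃ P : Fin r → AlgDS K n r,
    ∑ k, actDS f (P k * polyDS r (f k)) (genFs f) = evalSum f b

/-- `b` is a monic polynomial of lowest degree among those that satisfy the functional equation. -/
def IsBernsteinSatoPolynomial (b : Polynomial K) : Prop :=
  b.Monic ∧ FunctionalEquation f b ∧
    ∀ c : Polynomial K, c.Monic → FunctionalEquation f c → b.natDegree ≤ c.natDegree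

open Classical in
/-- The Bernstein-Sato polynomial `b_f` of `f = (f_1, …, f_r)`: the monic polynomial of lowest
degree that satisfies the functional equation (zero if no monic polynomial does). -/
def bernsteinSatoPolynomial : Polynomial K :=
  if h : ∃ b, IsBernsteinSatoPolynomial f b then h.choose else 0

end Module

end BernsteinSato

end

noncomputable section

namespace BernsteinSato

/-! The argument is the Mellin transform. The Weyl algebra D_n⟨t, ∂t⟩ acts on the module of f^s
(`actT`): t_j raises s_j by one and multiplies by f_j, while ∂t_j lowers s_j by one and multiplies
by -s_j/f_j. Under this action -∂t_i t_j is s_ij (`dtOp_mul_tOp`), and the Euler operator θ = ∑ t_j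
∂t_j is multiplication by -(s_1 + ⋯ + s_r) - r (`actT_euler`); this is the source of the
substitution s ↦ -s - r.

Three facts translate one definition into the other. The Malgrange ideal is exactly the annihilator
of f^s (`malgrangeIdeal_eq_annFs`): modulo it every operator becomes ∑ a_δ(x) ∂t^δ, and in
characteristic zero the elements ∂t^δ • f^s are independent over K[x]. An operator of weight 0 lies
in the initial ideal if and only if it is congruent modulo the ideal to one of negative weight
(`mem_initialIdeal_iff`). The operators of negative weight carry f^s exactly onto ∑ D_n⟨S⟩ f_k • f^s
(`map_actGen_weightSpan`): every ∂t_j is absorbed together with some t_k into -s_jk, and a t_k left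
over produces the factor f_k.

Hence p(θ) lies in in(I_f) if and only if p(-s - r) satisfies the functional equation. The solutions
of the functional equation form an ideal of K[s], because s_ii acts as multiplication by s_i, so
minimal degree means generator. The substitution s ↦ -s - r is an involution that respects
divisibility, and the sign restores monicity. Existence of either polynomial is not needed: one
exists if and only if the other does, and both default to zero otherwise. -/

theorem finsuppNat_induction {ι : Type*} {p : (ι →₀ ℕ) → Prop} (zero : p 0)
    (add_single : ∀ α i, p α → p (α + Finsupp.single i 1)) (α : ι →₀ ℕ) : p α := by
  classical
  induction α using Finsupp.induction with
  | zero => exact zero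
  | single_add i m α _ _ ih =>
    rw [add_comm]
    clear * - ih add_single
    induction m with
    | zero => simpa using ih
    | succ m hm =>
      rw [Finsupp.single_add, ← add_assoc]
      exact add_single _ i hm

theorem exists_eq_add_single {ι : Type*} {α : ι →₀ ℕ} {i : ι} (h : α i ≠ 0) :
    ∃ β, α = β + Finsupp.single i 1 :=
  ⟨α - Finsupp.single i 1, (tsub_add_cancel_of_le (by
    rw [Finsupp.single_le_iff]; omega)).symm⟩

/-! ### Products of powers of commuting elements -/

section NoncommProd

variable {ι A : Type*} [Fintype ι] [Monoid A] (X : ι → A)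

theorem noncommProd_pow_zero (comm) :
    Finset.univ.noncommProd (fun i => X i ^ (0 : ι →₀ ℕ) i) comm = 1 := by
  rw [Finset.noncommProd_eq_pow_card _ _ _ 1 (fun i _ => by simp), one_pow]

theorem noncommProd_pow_add (hX : ∀ i j, X i * X j = X j * X i) (α β : ι →₀ ℕ)
    (comm) (comm') (comm'') :
    Finset.univ.noncommProd (fun i => X i ^ (α + β) i) comm =
      Finset.univ.noncommProd (fun i => X i ^ α i) comm' *
        Finset.univ.noncommProd (fun i => X i ^ β i) comm'' := by
  rw [← Finset.noncommProd_mul_distrib]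
  · exact Finset.noncommProd_congr rfl (fun i _ => by simp [pow_add]) _
  · intro i _ j _ _
    exact Commute.pow_pow (hX i j) _ _

theorem noncommProd_pow_single (i : ι) (comm) :
    Finset.univ.noncommProd (fun j => X j ^ Finsupp.single i 1 j) comm = X i := by
  classical
  rw [← Finset.mul_noncommProd_erase Finset.univ (Finset.mem_univ i)]
  refine (congrArg (X i ^ Finsupp.single i 1 i * ·)
    (Finset.noncommProd_eq_pow_card _ _ _ 1 fun j hj => ?_)).trans ?_
  · simp [Finsupp.single_eq_of_ne (Finset.ne_of_mem_erase hj)]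
  · simp

end NoncommProd

namespace WeylAlgebra

/-! ### Monomials and commutation rules in the Weyl algebra -/

section General

variable {K : Type*} [Field K] {ι : Type*}

/-- The universal property gives a homomorphism into S whose composite with the inclusion fixes the
generators, hence is the identity. -/
theorem mem_of_generators (S : Subalgebra K (WeylAlgebra K ι)) (hx : ∀ i, x K i ∈ S)
    (hd : ∀ i, d K i ∈ S) (z : WeylAlgebra K ι) : z ∈ S := by
  let ψ : WeylAlgebra K ι →ₐ[K] S :=
    lift (fun i => ⟨x K i, hx i⟩) (fun i => ⟨d K i, hd i⟩)
      (fun i j => Subtype.ext (x_mul_x K i j)) (fun i j => Subtype.ext (d_mul_d K i j))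
      (fun i => Subtype.ext (d_mul_x_self K i)) (fun i j h => Subtype.ext (d_mul_x_ne K h))
  have h : S.val.comp ψ = AlgHom.id K _ := by
    apply hom_ext
    · intro i
      simp only [AlgHom.comp_apply, ψ, lift_x, Subalgebra.coe_val, AlgHom.id_apply]
    · intro i
      simp only [AlgHom.comp_apply, ψ, lift_d, Subalgebra.coe_val, AlgHom.id_apply]
  have := DFunLike.congr_fun h z
  rw [AlgHom.id_apply] at this
  rw [← this]
  exact (ψ z).2

/-- A subspace stable under left multiplication by the generators is a left ideal. -/
theorem mul_mem_of_generators (N : Submodule K (WeylAlgebra K ι))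
    (hx : ∀ i, ∀ z ∈ N, x K i * z ∈ N) (hd : ∀ i, ∀ z ∈ N, d K i * z ∈ N)
    (a z : WeylAlgebra K ι) (hz : z ∈ N) : a * z ∈ N := by
  let S : Subalgebra K (WeylAlgebra K ι) :=
    { carrier := {a | ∀ z ∈ N, a * z ∈ N}
      mul_mem' := fun {a b} ha hb z hz => by rw [mul_assoc]; exact ha _ (hb z hz)
      add_mem' := fun {a b} ha hb z hz => by rw [add_mul]; exact N.add_mem (ha z hz) (hb z hz)
      algebraMap_mem' := fun c z hz => by
        rw [← Algebra.smul_def]; exact N.smul_mem c hz }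
  exact mem_of_generators S hx hd a z hz

theorem d_mul_x [DecidableEq ι] (i j : ι) :
    d K i * x K j = x K j * d K i + if i = j then 1 else 0 := by
  split_ifs with h
  · subst h; exact d_mul_x_self K i
  · rw [add_zero]; exact d_mul_x_ne K h

variable [Fintype ι]

theorem xPow_zero : xPow K (0 : ι →₀ ℕ) = 1 := noncommProd_pow_zero _ _

theorem dPow_zero : dPow K (0 : ι →₀ ℕ) = 1 := noncommProd_pow_zero _ _

theorem xPow_add (α β : ι →₀ ℕ) : xPow K (α + β) = xPow K α * xPow K β :=
  noncommProd_pow_add _ (x_mul_x K) α β _ _ _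

theorem dPow_add (α β : ι →₀ ℕ) : dPow K (α + β) = dPow K α * dPow K β :=
  noncommProd_pow_add _ (d_mul_d K) α β _ _ _

theorem xPow_single (i : ι) : xPow K (Finsupp.single i 1) = x K i := noncommProd_pow_single _ i _

theorem dPow_single (i : ι) : dPow K (Finsupp.single i 1) = d K i := noncommProd_pow_single _ i _

theorem xPow_add_single (α : ι →₀ ℕ) (i : ι) :
    xPow K (α + Finsupp.single i 1) = x K i * xPow K α := by
  rw [add_comm, xPow_add, xPow_single]

theorem dPow_add_single (α : ι →₀ ℕ) (i : ι) :
    dPow K (α + Finsupp.single i 1) = d K i * dPow K α := by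
  rw [add_comm, dPow_add, dPow_single]

/-- The truncated subtraction is harmless: when α_i = 0 the coefficient of the last term vanishes.
-/
theorem d_mul_xPow (i : ι) (α : ι →₀ ℕ) :
    d K i * xPow K α = xPow K α * d K i + α i • xPow K (α - Finsupp.single i 1) := by
  classical
  induction α using finsuppNat_induction with
  | zero => simp [xPow_zero]
  | add_single α j ih =>
    rw [xPow_add_single, ← mul_assoc, d_mul_x, add_mul, mul_assoc, ih]
    split_ifs with h
    · subst h
      rw [add_tsub_cancel_right, mul_add, ← mul_assoc, one_mul, mul_smul_comm, ← xPow_add_single,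
        ← xPow_add_single]
      by_cases hα : α i = 0
      · simp [hα]
      · obtain ⟨β, rfl⟩ := exists_eq_add_single hα
        simp only [add_tsub_cancel_right, Finsupp.add_apply, Finsupp.single_eq_same]
        module
    · rw [zero_mul, add_zero, mul_add, ← mul_assoc, mul_smul_comm, ← xPow_add_single,
        ← xPow_add_single]
      congr 1
      simp only [Finsupp.add_apply, Finsupp.single_eq_of_ne h, add_zero]
      by_cases hα : α i = 0
      · simp [hα]
      · obtain ⟨β, rfl⟩ := exists_eq_add_single hα
        rw [add_right_comm, add_tsub_cancel_right, add_tsub_cancel_right]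

theorem ofPoly_eq_linearCombination (p : MvPolynomial ι K) :
    ofPoly p = Finsupp.linearCombination K (xPow K) (AddMonoidAlgebra.coeff p) := by
  rfl

theorem ofPoly_add (p q : MvPolynomial ι K) : ofPoly (p + q) = ofPoly p + ofPoly q := by
  simp only [ofPoly_eq_linearCombination, AddMonoidAlgebra.coeff_add, map_add]

theorem ofPoly_monomial (α : ι →₀ ℕ) (c : K) :
    ofPoly (MvPolynomial.monomial α c) = c • xPow K α := by
  rw [ofPoly_eq_linearCombination]
  exact Finsupp.linearCombination_single K c α

theorem ofPoly_C (c : K) : ofPoly (MvPolynomial.C c : MvPolynomial ι K) = algebraMap K _ c := by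
  rw [MvPolynomial.C_apply, ofPoly_monomial, xPow_zero, Algebra.algebraMap_eq_smul_one]

theorem ofPoly_mul (p q : MvPolynomial ι K) : ofPoly (p * q) = ofPoly p * ofPoly q := by
  induction p using MvPolynomial.induction_on' with
  | add p₁ p₂ h₁ h₂ => rw [add_mul, ofPoly_add, ofPoly_add, h₁, h₂, add_mul]
  | monomial α c =>
    induction q using MvPolynomial.induction_on' with
    | add p₁ p₂ h₁ h₂ => rw [mul_add, ofPoly_add, ofPoly_add, h₁, h₂, mul_add]
    | monomial β e =>
      rw [MvPolynomial.monomial_mul, ofPoly_monomial, ofPoly_monomial, ofPoly_monomial, xPow_add,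
        smul_mul_smul_comm]

/-- The inclusion `K[x] → D` as an algebra homomorphism. -/
def ofPolyHom : MvPolynomial ι K →ₐ[K] WeylAlgebra K ι where
  toFun := ofPoly
  map_one' := by rw [← MvPolynomial.C_1, ofPoly_C, map_one]
  map_mul' := ofPoly_mul
  map_zero' := by rw [← MvPolynomial.C_0, ofPoly_C, map_zero]
  map_add' := ofPoly_add
  commutes' := ofPoly_C

theorem ofPolyHom_apply (p : MvPolynomial ι K) : ofPolyHom p = ofPoly p := rfl

theorem ofPoly_X (i : ι) : ofPoly (MvPolynomial.X i : MvPolynomial ι K) = x K i := by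
  rw [MvPolynomial.X, ofPoly_monomial, xPow_single, one_smul]

theorem d_mul_ofPoly (i : ι) (p : MvPolynomial ι K) :
    d K i * ofPoly p = ofPoly p * d K i + ofPoly (MvPolynomial.pderiv i p) := by
  classical
  simp only [← ofPolyHom_apply]
  induction p using MvPolynomial.induction_on with
  | C c =>
    rw [MvPolynomial.pderiv_C, map_zero, add_zero, ofPolyHom_apply, ofPoly_C]
    exact (Algebra.commutes c (d K i)).symm
  | add p q hp hq => simp only [map_add, mul_add, add_mul, hp, hq]; abel
  | mul_X p j hp =>
    simp only [map_mul, Derivation.leibniz, smul_eq_mul, map_add, MvPolynomial.pderiv_X]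
    rw [← mul_assoc, hp, add_mul, mul_assoc, ofPolyHom_apply (MvPolynomial.X j), ofPoly_X,
      d_mul_x, mul_add, mul_assoc, ← ofPoly_X j, ← ofPolyHom_apply (MvPolynomial.X j), add_assoc,
      ← map_mul ofPolyHom (MvPolynomial.X j), mul_comm (MvPolynomial.X j) (MvPolynomial.pderiv i p),
      map_mul]
    congr 2
    by_cases h : i = j
    · subst h; simp
    · simp [h, Ne.symm h]

/-! ### The weight filtration -/

/-- The span of the monomials `x^α ∂^β` whose weight lies in `S`. -/
def weightSpan (w : ι → ℕ) (S : Set ℤ) : Submodule K (WeylAlgebra K ι) :=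
  Submodule.span K ((fun m : (ι →₀ ℕ) × (ι →₀ ℕ) => xPow K m.1 * dPow K m.2) ''
    {m | weight w m ∈ S})

theorem monomial_mem_weightSpan {w : ι → ℕ} {S : Set ℤ} {α β : ι →₀ ℕ}
    (h : weight w (α, β) ∈ S) : xPow K α * dPow K β ∈ weightSpan (K := K) w S :=
  Submodule.subset_span ⟨(α, β), h, rfl⟩

theorem weight_zero (w : ι → ℕ) : weight w 0 = 0 := by simp [weight]

theorem weight_add (w : ι → ℕ) (m m' : (ι →₀ ℕ) × (ι →₀ ℕ)) :
    weight w (m + m') = weight w m + weight w m' := by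
  simp only [weight, ← Finset.sum_add_distrib]
  refine Finset.sum_congr rfl fun i _ => ?_
  simp only [Prod.fst_add, Prod.snd_add, Finsupp.add_apply, Nat.cast_add]
  ring

theorem weight_single_left (w : ι → ℕ) (i : ι) :
    weight w (Finsupp.single i 1, 0) = - w i := by
  classical
  simp [weight, Finsupp.single_apply]

theorem weight_single_right (w : ι → ℕ) (i : ι) :
    weight w (0, Finsupp.single i 1) = w i := by
  classical
  simp [weight, Finsupp.single_apply]

theorem weight_add_single_left (w : ι → ℕ) (α β : ι →₀ ℕ) (i : ι) :
    weight w (α + Finsupp.single i 1, β) = weight w (α, β) - w i := by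
  have : ((α + Finsupp.single i 1, β) : (ι →₀ ℕ) × (ι →₀ ℕ)) =
      (α, β) + (Finsupp.single i 1, 0) := by simp
  rw [this, weight_add, weight_single_left, sub_eq_add_neg]

theorem weight_add_single_right (w : ι → ℕ) (α β : ι →₀ ℕ) (i : ι) :
    weight w (α, β + Finsupp.single i 1) = weight w (α, β) + w i := by
  have : ((α, β + Finsupp.single i 1) : (ι →₀ ℕ) × (ι →₀ ℕ)) =
      (α, β) + (0, Finsupp.single i 1) := by simp
  rw [this, weight_add, weight_single_right]

theorem x_mul_mem_weightSpan {w : ι → ℕ} {S S' : Set ℤ} (i : ι) (h : ∀ k ∈ S, k - w i ∈ S')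
    {z : WeylAlgebra K ι} (hz : z ∈ weightSpan (K := K) w S) :
    x K i * z ∈ weightSpan (K := K) w S' := by
  induction hz using Submodule.span_induction with
  | mem z hz =>
    obtain ⟨⟨α, β⟩, hm, rfl⟩ := hz
    simp only
    rw [← mul_assoc, ← xPow_add_single]
    apply monomial_mem_weightSpan
    rw [weight_add_single_left]
    exact h _ hm
  | zero => simp
  | add a b _ _ ha hb => rw [mul_add]; exact add_mem ha hb
  | smul c a _ ha => rw [mul_smul_comm]; exact Submodule.smul_mem _ c ha

/-- Moving ∂_i past x^α gives one term with an extra ∂_i and one with an x_i removed; both changes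
raise the weight by w_i. -/
theorem d_mul_mem_weightSpan {w : ι → ℕ} {S S' : Set ℤ} (i : ι) (h : ∀ k ∈ S, k + w i ∈ S')
    {z : WeylAlgebra K ι} (hz : z ∈ weightSpan (K := K) w S) :
    d K i * z ∈ weightSpan (K := K) w S' := by
  induction hz using Submodule.span_induction with
  | mem z hz =>
    obtain ⟨⟨α, β⟩, hm, rfl⟩ := hz
    simp only
    rw [← mul_assoc, d_mul_xPow, add_mul, mul_assoc, ← dPow_add_single, smul_mul_assoc]
    refine add_mem (monomial_mem_weightSpan ?_) ?_
    · rw [weight_add_single_right]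
      exact h _ hm
    · by_cases hα : α i = 0
      · rw [hα, zero_smul]; exact zero_mem _
      · obtain ⟨α, rfl⟩ := exists_eq_add_single hα
        rw [add_tsub_cancel_right]
        refine nsmul_mem (monomial_mem_weightSpan ?_) _
        have := h _ hm
        rwa [weight_add_single_left, sub_add_cancel] at this
  | zero => simp
  | add a b _ _ ha hb => rw [mul_add]; exact add_mem ha hb
  | smul c a _ ha => rw [mul_smul_comm]; exact Submodule.smul_mem _ c ha

theorem one_mem_weightSpan {w : ι → ℕ} {S : Set ℤ} (h : 0 ∈ S) :
    (1 : WeylAlgebra K ι) ∈ weightSpan (K := K) w S := by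
  have : weight w ((0 : ι →₀ ℕ), (0 : ι →₀ ℕ)) ∈ S := by rwa [← Prod.zero_eq_mk, weight_zero]
  simpa [xPow_zero, dPow_zero] using monomial_mem_weightSpan (K := K) this

theorem mem_weightSpan_iff {w : ι → ℕ} {S : Set ℤ} {z : WeylAlgebra K ι} :
    z ∈ weightSpan (K := K) w S ↔
      ∃ c : ((ι →₀ ℕ) × (ι →₀ ℕ)) →₀ K, (∀ m ∈ c.support, weight w m ∈ S) ∧ ofCoeff c = z := by
  rw [weightSpan, Finsupp.mem_span_image_iff_linearCombination]
  rfl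

theorem ofCoeff_mem_weightSpan {w : ι → ℕ} {S : Set ℤ} {c : ((ι →₀ ℕ) × (ι →₀ ℕ)) →₀ K}
    (h : ∀ m ∈ c.support, weight w m ∈ S) : ofCoeff c ∈ weightSpan (K := K) w S :=
  mem_weightSpan_iff.2 ⟨c, h, rfl⟩

theorem ofCoeff_sub (c c' : ((ι →₀ ℕ) × (ι →₀ ℕ)) →₀ K) :
    ofCoeff (c - c') = ofCoeff c - ofCoeff c' :=
  map_sub (Finsupp.linearCombination K fun m : (ι →₀ ℕ) × (ι →₀ ℕ) => xPow K m.1 * dPow K m.2) c c'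

theorem euler_mul_mem_weightSpan (w : ι → ℕ) {S : Set ℤ} {z : WeylAlgebra K ι}
    (hz : z ∈ weightSpan (K := K) w S) : euler K w * z ∈ weightSpan (K := K) w S := by
  rw [euler, Finset.sum_mul]
  refine sum_mem fun i _ => ?_
  rw [smul_mul_assoc, mul_assoc]
  refine nsmul_mem (x_mul_mem_weightSpan (S := {k | k - w i ∈ S}) i (fun k hk => hk)
    (d_mul_mem_weightSpan i (fun k hk => ?_) hz)) _
  simpa using hk

theorem aeval_euler_mem_weightSpan (w : ι → ℕ) (p : Polynomial K) :
    Polynomial.aeval (euler K w) p ∈ weightSpan (K := K) w {0} := by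
  induction p using Polynomial.induction_on' with
  | add p q hp hq => rw [map_add]; exact add_mem hp hq
  | monomial k c =>
    rw [Polynomial.aeval_monomial, ← Algebra.smul_def]
    refine Submodule.smul_mem _ c ?_
    induction k with
    | zero => rw [pow_zero]; exact one_mem_weightSpan rfl
    | succ k ih => rw [pow_succ']; exact euler_mul_mem_weightSpan w ih

/-- The coaction of the grading by the weight. -/
def gradingHom (w : ι → ℕ) : WeylAlgebra K ι →ₐ[K] AddMonoidAlgebra (WeylAlgebra K ι) ℤ :=
  lift (fun i => AddMonoidAlgebra.single (-w i) (x K i))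
    (fun i => AddMonoidAlgebra.single (w i) (d K i))
    (fun i j => by rw [AddMonoidAlgebra.single_mul_single, AddMonoidAlgebra.single_mul_single,
      x_mul_x, add_comm])
    (fun i j => by rw [AddMonoidAlgebra.single_mul_single, AddMonoidAlgebra.single_mul_single,
      d_mul_d, add_comm])
    (fun i => by
      rw [AddMonoidAlgebra.single_mul_single, AddMonoidAlgebra.single_mul_single, d_mul_x_self,
        AddMonoidAlgebra.single_add, add_neg_cancel, neg_add_cancel, AddMonoidAlgebra.one_def])
    (fun i j h => by rw [AddMonoidAlgebra.single_mul_single, AddMonoidAlgebra.single_mul_single,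
      d_mul_x_ne K h, add_comm])

theorem gradingHom_monomial (w : ι → ℕ) (α β : ι →₀ ℕ) :
    gradingHom w (xPow K α * dPow K β) =
      AddMonoidAlgebra.single (weight w (α, β)) (xPow K α * dPow K β) := by
  induction α using finsuppNat_induction with
  | zero =>
    induction β using finsuppNat_induction with
    | zero =>
      rw [← Prod.zero_eq_mk, weight_zero, xPow_zero, dPow_zero, mul_one, map_one,
        AddMonoidAlgebra.one_def]
    | add_single β i ih =>
      rw [xPow_zero, one_mul] at ih ⊢
      rw [dPow_add_single, map_mul, ih, gradingHom, lift_d, AddMonoidAlgebra.single_mul_single,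
        weight_add_single_right, add_comm]
  | add_single α i ih =>
    rw [xPow_add_single, mul_assoc, map_mul, ih, gradingHom, lift_x,
      AddMonoidAlgebra.single_mul_single, weight_add_single_left, sub_eq_neg_add]

/-- This makes homogeneous components well defined without knowing that the monomials x^α ∂^β are
linearly independent. -/
theorem gradingHom_of_mem {w : ι → ℕ} {k : ℤ} {z : WeylAlgebra K ι}
    (hz : z ∈ weightSpan (K := K) w {k}) : gradingHom w z = AddMonoidAlgebra.single k z := by
  induction hz using Submodule.span_induction with
  | mem z hz =>
    obtain ⟨⟨α, β⟩, hm, rfl⟩ := hz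
    rw [gradingHom_monomial, show weight w (α, β) = k from hm]
  | zero => simp
  | add a b _ _ ha hb => rw [map_add, ha, hb, AddMonoidAlgebra.single_add]
  | smul c a _ ha => rw [map_smul, ha, AddMonoidAlgebra.smul_single]

theorem weight_eq_of_mem_support_initialCoeff {w : ι → ℕ} {c : ((ι →₀ ℕ) × (ι →₀ ℕ)) →₀ K}
    {m m' : (ι →₀ ℕ) × (ι →₀ ℕ)} (hm : m ∈ (initialCoeff w c).support)
    (hm' : m' ∈ (initialCoeff w c).support) : weight w m' = weight w m := by
  classical
  rw [initialCoeff, Finsupp.support_filter, Finset.mem_filter] at hm hm'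
  exact le_antisymm (hm.2 _ hm'.1) (hm'.2 _ hm.1)

/-- An element of weight `0` lies in the initial ideal of `I` if and only if it is congruent modulo
`I` to an element of negative weight. -/
theorem mem_initialIdeal_iff (w : ι → ℕ) (I : Ideal (WeylAlgebra K ι)) {z : WeylAlgebra K ι}
    (hz : z ∈ weightSpan (K := K) w {0}) :
    z ∈ initialIdeal w I ↔ ∃ q ∈ weightSpan (K := K) w (Set.Iio 0), z - q ∈ I := by
  classical
  constructor
  · intro h
    -- Elements of the span need not be homogeneous, so the claim is made for the weight-0
    -- component, which is linear in z and equals z here.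
    suffices H : ∀ z ∈ initialIdeal w I,
        ∃ q ∈ weightSpan (K := K) w (Set.Iio 0), (gradingHom w z).coeff 0 - q ∈ I by
      have := H z h
      rwa [gradingHom_of_mem hz, AddMonoidAlgebra.coeff_single, Finsupp.single_eq_same] at this
    clear z hz h
    intro z hz
    induction hz using Submodule.span_induction with
    | mem z hz =>
      obtain ⟨c, hc, rfl⟩ := hz
      have hk : ∃ k, ∀ m ∈ (initialCoeff w c).support, weight w m ∈ ({k} : Set ℤ) := by
        by_cases he : ∃ m, m ∈ (initialCoeff w c).support
        · obtain ⟨m, hm⟩ := he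
          exact ⟨weight w m, fun m' hm' => weight_eq_of_mem_support_initialCoeff hm hm'⟩
        · exact ⟨1, fun m hm => (he ⟨m, hm⟩).elim⟩
      -- An initial form is homogeneous. If its weight is 0, it differs from the element of I only
      -- by terms of negative weight; otherwise its weight-0 component is zero.
      by_cases h0 : ∃ m ∈ (initialCoeff w c).support, weight w m = 0
      · obtain ⟨m, hm, hm0⟩ := h0
        have h1 : ∀ m' ∈ (initialCoeff w c).support, weight w m' ∈ ({0} : Set ℤ) := fun m' hm' =>
          (weight_eq_of_mem_support_initialCoeff hm hm').trans hm0
        rw [gradingHom_of_mem (ofCoeff_mem_weightSpan h1), AddMonoidAlgebra.coeff_single,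
          Finsupp.single_eq_same]
        refine ⟨ofCoeff (initialCoeff w c - c), ofCoeff_mem_weightSpan fun m' hm' => ?_, ?_⟩
        · rw [Finsupp.mem_support_iff, Finsupp.sub_apply, initialCoeff, Finsupp.filter_apply] at hm'
          rw [initialCoeff, Finsupp.support_filter, Finset.mem_filter] at hm
          split_ifs at hm' with hmax
          · simp at hm'
          · have hs : m' ∈ c.support := by
              rw [Finsupp.mem_support_iff]; intro h; simp [h] at hm'
            push Not at hmax
            obtain ⟨m'', hm'', hlt⟩ := hmax
            exact hlt.trans_le ((hm.2 m'' hm'').trans_eq hm0)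
        · rw [ofCoeff_sub, sub_sub_cancel]
          exact hc
      · obtain ⟨k, hk⟩ := hk
        refine ⟨0, zero_mem _, ?_⟩
        rw [gradingHom_of_mem (ofCoeff_mem_weightSpan hk), AddMonoidAlgebra.coeff_single, sub_zero]
        by_cases hk0 : k = 0
        · have hI : initialCoeff w c = 0 := by
            rw [← Finsupp.support_eq_empty, Finset.eq_empty_iff_forall_notMem]
            exact fun m hm => h0 ⟨m, hm, (hk m hm).trans hk0⟩
          simp [hI, ofCoeff]
        · rw [Finsupp.single_eq_of_ne (Ne.symm hk0)]
          exact zero_mem _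
    | zero => exact ⟨0, zero_mem _, by simp⟩
    | add a b _ _ ha hb =>
      obtain ⟨q, hq, hqI⟩ := ha
      obtain ⟨q', hq', hqI'⟩ := hb
      refine ⟨q + q', add_mem hq hq', ?_⟩
      rw [map_add, AddMonoidAlgebra.coeff_add, Finsupp.add_apply, add_sub_add_comm]
      exact add_mem hqI hqI'
    | smul t a _ ha =>
      obtain ⟨q, hq, hqI⟩ := ha
      refine ⟨t • q, Submodule.smul_mem _ _ hq, ?_⟩
      rw [map_smul, AddMonoidAlgebra.coeff_smul, Finsupp.smul_apply, ← smul_sub]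
      exact Submodule.smul_of_tower_mem I t hqI
  · rintro ⟨q, hq, hI⟩
    obtain ⟨c, hc, rfl⟩ := mem_weightSpan_iff.1 hz
    obtain ⟨e, he, rfl⟩ := mem_weightSpan_iff.1 hq
    -- The initial form of c - e is c only when c ≠ 0; otherwise it comes from e.
    by_cases h0 : c = 0
    · rw [h0]
      exact (initialIdeal w I).zero_mem
    refine Submodule.subset_span ⟨c - e, by rwa [ofCoeff_sub], congrArg _ ?_⟩
    -- The supports are disjoint, as c sits in weight 0 and e in negative weights, so no
    -- cancellation can occur.
    have hce : ∀ m, c m ≠ 0 → e m = 0 := by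
      intro m hm
      by_contra hne
      have h1 : weight w m = 0 := hc m (Finsupp.mem_support_iff.2 hm)
      have h2 : weight w m < 0 := he m (Finsupp.mem_support_iff.2 hne)
      omega
    obtain ⟨m₀, hm₀⟩ := Finsupp.support_nonempty_iff.2 h0
    have hm₀' : m₀ ∈ (c - e).support := by
      rw [Finsupp.mem_support_iff] at hm₀ ⊢
      simpa [hce _ hm₀] using hm₀
    ext m
    rw [initialCoeff, Finsupp.filter_apply]
    by_cases hm : c m = 0
    · rw [hm]
      split_ifs with hmax
      · by_contra hne
        have h3 : e m ≠ 0 := by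
          intro h; simp [hm, h] at hne
        have h1 : weight w m < 0 := he m (Finsupp.mem_support_iff.2 h3)
        have h2 : weight w m₀ = 0 := hc m₀ hm₀
        have := hmax m₀ hm₀'
        omega
      · rfl
    · rw [if_pos, Finsupp.sub_apply, hce m hm, sub_zero]
      intro m' hm'
      have h1 : weight w m = 0 := hc m (Finsupp.mem_support_iff.2 hm)
      rw [h1]
      by_cases hcm : c m' = 0
      · have h3 : e m' ≠ 0 := by
          intro h; simp [hcm, h] at hm'
        exact le_of_lt (he m' (Finsupp.mem_support_iff.2 h3))
      · exact le_of_eq (hc m' (Finsupp.mem_support_iff.2 hcm))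

end General

end WeylAlgebra

/-! ### The action of D_n⟨t, ∂t⟩ on the module of f^s -/

section MellinAction

open WeylAlgebra

variable {K : Type*} [Field K] {n r : ℕ} (f : Fin r → MvPolynomial (Fin n) K)

theorem shift_zero (G : ModuleFs f) : shift f 0 G = G := by
  have h : ((shift f (0 : Fin r → K)) : ModuleFs f →+* ModuleFs f) = RingHom.id _ := by
    apply IsLocalization.ringHom_ext (Submonoid.powers (prodF f))
    apply RingHom.ext
    intro p
    change shift f 0 (coef f p) = coef f p
    rw [shift_coef]
    refine congrArg (coef f) ?_
    have h0 : shiftPoly n (0 : Fin r → K) = AlgHom.id K _ := by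
      apply MvPolynomial.algHom_ext
      rintro (m | i) <;> simp [shiftPoly]
    exact DFunLike.congr_fun h0 p
  exact RingHom.congr_fun h G

theorem shift_xElt (a : Fin r → K) (m : Fin n) : shift f a (xElt f m) = xElt f m := by
  rw [xElt, shift_coef]; simp [shiftPoly]

theorem shift_logDer (a : Fin r → K) (m : Fin n) :
    shift f a (logDer f m) = logDer f m +
      ∑ i, algebraMap K _ (a i) * partialX f m (fElt f i) * fInv f i := by
  simp only [logDer, map_sum, map_mul, shift_coef_inclX, shift_fInv, shift_sElt, add_mul,
    Finset.sum_add_distrib, partialX_fElt]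

theorem shift_single_logDer (c : K) (j : Fin r) (m : Fin n) :
    shift f (Pi.single j c) (logDer f m) = logDer f m +
      algebraMap K _ c * partialX f m (fElt f j) * fInv f j := by
  rw [shift_logDer, Finset.sum_eq_single j]
  · rw [Pi.single_eq_same]
  · intro i _ hi
    rw [Pi.single_eq_of_ne hi, map_zero, zero_mul, zero_mul]
  · simp

/-- The action of `t_j` on `M`: `t_j • (G(s) f^s) = G(s + ε_j) f_j f^s`. -/
def tOp (j : Fin r) : Module.End K (ModuleFs f) :=
  LinearMap.mulLeft K (fElt f j) ∘ₗ (shift f (Pi.single j 1)).toLinearMap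

/-- The action of `∂t_j` on `M`: `∂t_j • (G(s) f^s) = - s_j G(s - ε_j) / f_j f^s`. -/
def dtOp (j : Fin r) : Module.End K (ModuleFs f) :=
  LinearMap.mulLeft K (-(sElt f j * fInv f j)) ∘ₗ (shift f (Pi.single j (-1))).toLinearMap

theorem tOp_apply (j : Fin r) (G : ModuleFs f) :
    tOp f j G = fElt f j * shift f (Pi.single j 1) G := rfl

theorem dtOp_apply (j : Fin r) (G : ModuleFs f) :
    dtOp f j G = -(sElt f j * fInv f j) * shift f (Pi.single j (-1)) G := rfl

theorem tOp_mul_tOp (i j : Fin r) : tOp f i * tOp f j = tOp f j * tOp f i := by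
  ext G
  simp only [Module.End.mul_apply, tOp_apply, map_mul, shift_fElt, shift_shift]
  rw [add_comm (Pi.single i 1 : Fin r → K)]
  ring

theorem dtOp_mul_dtOp (i j : Fin r) : dtOp f i * dtOp f j = dtOp f j * dtOp f i := by
  -- For i ≠ j the shift in s_i leaves s_j alone, which is what makes the two factors commute.
  by_cases h : i = j
  · rw [h]
  ext G
  simp only [Module.End.mul_apply, dtOp_apply, map_mul, map_neg, shift_fInv, shift_shift,
    shift_sElt, Pi.single_eq_of_ne h, Pi.single_eq_of_ne (Ne.symm h), map_zero, add_zero]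
  rw [add_comm (Pi.single i (-1) : Fin r → K)]
  ring

theorem single_neg_one_add (j : Fin r) :
    (Pi.single j (-1) + Pi.single j 1 : Fin r → K) = 0 := by
  rw [← Pi.single_add, neg_add_cancel, Pi.single_zero]

/-- Here ∂t_j t_j acts as -s_j and t_j ∂t_j as -(s_j + 1). -/
theorem dtOp_mul_tOp_self (j : Fin r) : dtOp f j * tOp f j = tOp f j * dtOp f j + 1 := by
  ext G
  simp only [LinearMap.add_apply, Module.End.one_apply, Module.End.mul_apply, tOp_apply, dtOp_apply,
    map_mul, map_neg, shift_fElt, shift_fInv, shift_shift, shift_sElt, Pi.single_eq_same, map_one,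
    add_comm (Pi.single j 1 : Fin r → K), single_neg_one_add, shift_zero]
  linear_combination G * fElt_mul_fInv f j

theorem dtOp_mul_tOp_ne (i j : Fin r) (h : i ≠ j) : dtOp f i * tOp f j = tOp f j * dtOp f i := by
  ext G
  simp only [Module.End.mul_apply, tOp_apply, dtOp_apply, map_mul, map_neg, shift_fElt, shift_fInv,
    shift_shift, shift_sElt, Pi.single_eq_of_ne h, map_zero, add_zero]
  rw [add_comm (Pi.single i (-1) : Fin r → K)]
  ring

theorem xOp_mul_tOp (m : Fin n) (j : Fin r) : xOp f m * tOp f j = tOp f j * xOp f m := by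
  ext G
  simp only [Module.End.mul_apply, xOp_apply, tOp_apply, map_mul, shift_xElt]
  ring

theorem xOp_mul_dtOp (m : Fin n) (j : Fin r) : xOp f m * dtOp f j = dtOp f j * xOp f m := by
  ext G
  simp only [Module.End.mul_apply, xOp_apply, dtOp_apply, map_mul, shift_xElt]
  ring

/-- Raising s_j by one adds (∂f_j/∂x_m)/f_j to the logarithmic derivative, which matches the
derivative of the new factor f_j. -/
theorem dOp_mul_tOp (m : Fin n) (j : Fin r) : dOp f m * tOp f j = tOp f j * dOp f m := by
  ext G
  simp only [Module.End.mul_apply, dOp_apply, tOp_apply, map_mul, map_add, shift_single_logDer,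
    Derivation.leibniz, smul_eq_mul, partialX_shift, map_one]
  linear_combination (-(partialX f m (fElt f j) * shift f (Pi.single j 1) G)) * fElt_mul_fInv f j

theorem dOp_mul_dtOp (m : Fin n) (j : Fin r) : dOp f m * dtOp f j = dtOp f j * dOp f m := by
  ext G
  simp only [Module.End.mul_apply, dOp_apply, dtOp_apply, map_mul, map_add, shift_single_logDer,
    Derivation.leibniz, smul_eq_mul, partialX_shift, map_one, map_neg, partialX_sElt,
    partialX_fInv]
  ring

/-- The action of `D_n⟨t, ∂t⟩` on `M`. -/
def actT : WeylAlgebra K (Fin n ⊕ Fin r) →ₐ[K] Module.End K (ModuleFs f) :=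
  WeylAlgebra.lift (Sum.elim (xOp f) (tOp f)) (Sum.elim (dOp f) (dtOp f))
    (by
      rintro (i | i) (j | j)
      · exact xOp_mul_xOp f i j
      · exact xOp_mul_tOp f i j
      · exact (xOp_mul_tOp f j i).symm
      · exact tOp_mul_tOp f i j)
    (by
      rintro (i | i) (j | j)
      · exact dOp_mul_dOp f i j
      · exact dOp_mul_dtOp f i j
      · exact (dOp_mul_dtOp f j i).symm
      · exact dtOp_mul_dtOp f i j)
    (by
      rintro (i | i)
      · exact dOp_mul_xOp_self f i
      · exact dtOp_mul_tOp_self f i)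
    (by
      rintro (i | i) (j | j) h
      · exact dOp_mul_xOp_ne f i j (fun e => h (congrArg _ e))
      · exact dOp_mul_tOp f i j
      · exact (xOp_mul_dtOp f j i).symm
      · exact dtOp_mul_tOp_ne f i j (fun e => h (congrArg _ e)))

theorem actT_x_inl (m : Fin n) : actT f (x K (Sum.inl m)) = xOp f m := lift_x ..

theorem actT_x_inr (j : Fin r) : actT f (x K (Sum.inr j)) = tOp f j := lift_x ..

theorem actT_d_inl (m : Fin n) : actT f (d K (Sum.inl m)) = dOp f m := lift_d ..

theorem actT_d_inr (j : Fin r) : actT f (d K (Sum.inr j)) = dtOp f j := lift_d ..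

variable (K n r) in
/-- The inclusion of `K[x]` in `D_n⟨t, ∂t⟩` as an algebra homomorphism. -/
def polyXTHom : MvPolynomial (Fin n) K →ₐ[K] WeylAlgebra K (Fin n ⊕ Fin r) :=
  ofPolyHom.comp (MvPolynomial.rename Sum.inl)

theorem polyXTHom_apply (p : MvPolynomial (Fin n) K) : polyXTHom K n r p = polyXT r p := rfl

theorem polyXT_X (m : Fin n) :
    polyXT r (MvPolynomial.X m : MvPolynomial (Fin n) K) = x K (Sum.inl m) := by
  rw [polyXT, MvPolynomial.rename_X, ofPoly_X]

theorem algHom_X_eq {φ : MvPolynomial (Fin n) K →ₐ[K] Module.End K (ModuleFs f)}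
    (h : ∀ m, φ (MvPolynomial.X m) = xOp f m) (p : MvPolynomial (Fin n) K) (G : ModuleFs f) :
    φ p G = coef f (inclX r p) * G := by
  have : φ = (Algebra.lmul K (ModuleFs f)).comp ((coef f).comp (inclX r)) := by
    apply MvPolynomial.algHom_ext
    intro m
    rw [h]
    ext G
    simp [xOp_apply, xElt, inclX]
  rw [this]
  rfl

theorem actT_polyXT (p : MvPolynomial (Fin n) K) (G : ModuleFs f) :
    actT f (polyXT r p) G = coef f (inclX r p) * G :=
  algHom_X_eq f (φ := (actT f).comp (polyXTHom K n r))
    (fun m => by rw [AlgHom.comp_apply, polyXTHom_apply, polyXT_X, actT_x_inl]) p G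

theorem actD_ofPoly (p : MvPolynomial (Fin n) K) (G : ModuleFs f) :
    actD f (ofPoly p) G = coef f (inclX r p) * G :=
  algHom_X_eq f (φ := (actD f).comp ofPolyHom)
    (fun m => by rw [AlgHom.comp_apply, ofPolyHom_apply, ofPoly_X, actD, lift_x]) p G

/-- The left ideal of operators annihilating `f^s`. -/
def annFs : Ideal (WeylAlgebra K (Fin n ⊕ Fin r)) where
  carrier := {z | actT f z (genFs f) = 0}
  zero_mem' := by simp
  add_mem' := fun {a b} ha hb => by
    simp only [Set.mem_ofPred_eq] at ha hb ⊢
    rw [map_add, LinearMap.add_apply, ha, hb, add_zero]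
  smul_mem' := fun a b hb => by
    simp only [Set.mem_ofPred_eq] at hb ⊢
    rw [smul_eq_mul, map_mul, Module.End.mul_apply, hb, map_zero]

theorem mem_annFs {z : WeylAlgebra K (Fin n ⊕ Fin r)} :
    z ∈ annFs f ↔ actT f z (genFs f) = 0 := Iff.rfl

/-- It suffices to test the generators: t_i • f^s = f_i f^s, and the terms -s_j/f_j from ∂t_j cancel
the logarithmic derivative coming from ∂_m. -/
theorem malgrangeIdeal_le_annFs : malgrangeIdeal f ≤ annFs f := by
  rw [malgrangeIdeal, Ideal.span_le]
  rintro _ (⟨i, rfl⟩ | ⟨m, rfl⟩)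
  · simp only [SetLike.mem_coe]
    rw [mem_annFs, map_sub, LinearMap.sub_apply, actT_x_inr, actT_polyXT, tOp_apply, genFs, map_one,
      fElt, sub_self]
  · simp only [SetLike.mem_coe]
    rw [mem_annFs, map_add, LinearMap.add_apply, actT_d_inl, map_sum, LinearMap.sum_apply]
    simp only [map_mul, Module.End.mul_apply, actT_polyXT, actT_d_inr, dOp_apply, dtOp_apply, genFs,
      map_one, Derivation.map_one_eq_zero, logDer, mul_one, zero_add]
    rw [← Finset.sum_add_distrib]
    exact Finset.sum_eq_zero fun i _ => by ring

/-! ### Reduction modulo the Malgrange ideal -/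

variable (K n) in
/-- The monomial `∂t^δ`. -/
def dtPow (δ : Fin r →₀ ℕ) : WeylAlgebra K (Fin n ⊕ Fin r) :=
  dPow K (δ.mapDomain Sum.inr)

theorem dtPow_zero : dtPow K n (0 : Fin r →₀ ℕ) = 1 := by
  rw [dtPow, Finsupp.mapDomain_zero, dPow_zero]

theorem dtPow_add_single (δ : Fin r →₀ ℕ) (j : Fin r) :
    dtPow K n (δ + Finsupp.single j 1) = d K (Sum.inr j) * dtPow K n δ := by
  rw [dtPow, Finsupp.mapDomain_add, Finsupp.mapDomain_single, dPow_add_single, dtPow]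

theorem dt_mul_polyXT (j : Fin r) (p : MvPolynomial (Fin n) K) :
    d K (Sum.inr j) * polyXT r p = polyXT r p * d K (Sum.inr j) := by
  have h : MvPolynomial.pderiv (Sum.inr j : Fin n ⊕ Fin r) (MvPolynomial.rename Sum.inl p) = 0 := by
    induction p using MvPolynomial.induction_on with
    | C c => simp
    | add p q hp hq => simp [hp, hq]
    | mul_X p m hp => simp [Derivation.leibniz, hp, MvPolynomial.pderiv_X]
  rw [polyXT, d_mul_ofPoly, h, ← ofPolyHom_apply 0, map_zero, add_zero]

theorem d_mul_polyXT (m : Fin n) (p : MvPolynomial (Fin n) K) :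
    d K (Sum.inl m) * polyXT r p =
      polyXT r p * d K (Sum.inl m) + polyXT r (MvPolynomial.pderiv m p) := by
  rw [polyXT, d_mul_ofPoly, MvPolynomial.pderiv_rename Sum.inl_injective, polyXT]

theorem t_mul_polyXT (j : Fin r) (p : MvPolynomial (Fin n) K) :
    x K (Sum.inr j) * polyXT r p = polyXT r p * x K (Sum.inr j) := by
  rw [polyXT, ← ofPoly_X, ← ofPoly_mul, ← ofPoly_mul, mul_comm]

/-- The linear map `(a_δ)_δ ↦ ∑ a_δ(x) ∂t^δ`. -/
def normalForm : ((Fin r →₀ ℕ) →₀ MvPolynomial (Fin n) K) →ₗ[K] WeylAlgebra K (Fin n ⊕ Fin r) :=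
  Finsupp.lsum K fun δ =>
    LinearMap.mulRight K (dtPow K n δ) ∘ₗ (polyXTHom K n r).toLinearMap

theorem normalForm_single (δ : Fin r →₀ ℕ) (p : MvPolynomial (Fin n) K) :
    normalForm (Finsupp.single δ p) = polyXT r p * dtPow K n δ := by
  rw [normalForm, Finsupp.lsum_single]
  rfl

/-- The operators congruent modulo the Malgrange ideal to one of the form `∑ a_δ(x) ∂t^δ`. -/
def reducible : Submodule K (WeylAlgebra K (Fin n ⊕ Fin r)) :=
  LinearMap.range (normalForm (K := K) (n := n) (r := r)) ⊔ (malgrangeIdeal f).restrictScalars K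

theorem polyXT_mul_dtPow_mem (p : MvPolynomial (Fin n) K) (δ : Fin r →₀ ℕ) :
    polyXT r p * dtPow K n δ ∈ reducible f :=
  Submodule.mem_sup_left ⟨_, normalForm_single δ p⟩

theorem dtPow_mem (δ : Fin r →₀ ℕ) : dtPow K n δ ∈ reducible f := by
  simpa [← polyXTHom_apply] using polyXT_mul_dtPow_mem f 1 δ

theorem mem_reducible_of_mem {z : WeylAlgebra K (Fin n ⊕ Fin r)} (hz : z ∈ malgrangeIdeal f) :
    z ∈ reducible f :=
  Submodule.mem_sup_right hz

/-- Left multiplication by `a` preserves reducible operators if it does so on the operators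
`p(x) ∂t^δ`. -/
theorem mul_mem_reducible {a : WeylAlgebra K (Fin n ⊕ Fin r)}
    (h : ∀ p δ, a * (polyXT r p * dtPow K n δ) ∈ reducible f)
    {z : WeylAlgebra K (Fin n ⊕ Fin r)} (hz : z ∈ reducible f) : a * z ∈ reducible f := by
  obtain ⟨_, ⟨c, rfl⟩, y, hy, rfl⟩ := Submodule.mem_sup.1 hz
  rw [mul_add]
  refine add_mem ?_ (mem_reducible_of_mem f ((malgrangeIdeal f).mul_mem_left a hy))
  induction c using Finsupp.induction_linear with
  | zero => simp
  | add c c' hc hc' =>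
    rw [map_add, mul_add]
    refine add_mem (hc ?_) (hc' ?_) <;>
    exact add_mem (Submodule.mem_sup_left ⟨_, rfl⟩) (mem_reducible_of_mem f hy)
  | single δ p => rw [normalForm_single]; exact h p δ

theorem polyXT_mul_mem_reducible (q : MvPolynomial (Fin n) K)
    {z : WeylAlgebra K (Fin n ⊕ Fin r)} (hz : z ∈ reducible f) : polyXT r q * z ∈ reducible f := by
  refine mul_mem_reducible f (fun p δ => ?_) hz
  rw [← mul_assoc, ← polyXTHom_apply, ← polyXTHom_apply, ← map_mul, polyXTHom_apply]
  exact polyXT_mul_dtPow_mem f _ δ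

theorem dt_mul_mem_reducible (j : Fin r)
    {z : WeylAlgebra K (Fin n ⊕ Fin r)} (hz : z ∈ reducible f) :
    d K (Sum.inr j) * z ∈ reducible f := by
  refine mul_mem_reducible f (fun p δ => ?_) hz
  rw [← mul_assoc, dt_mul_polyXT, mul_assoc, ← dtPow_add_single]
  exact polyXT_mul_dtPow_mem f _ _

/-- In a left ideal the relation t_i ≡ f_i applies only at the right end, so t_i is first moved
through ∂t^δ; each commutator is a lower power of ∂t. -/
theorem t_mul_dtPow_mem (i : Fin r) (δ : Fin r →₀ ℕ) :
    x K (Sum.inr i) * dtPow K n δ ∈ reducible f := by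
  classical
  induction δ using finsuppNat_induction with
  | zero =>
    have h : x K (Sum.inr i) - polyXT r (f i) ∈ malgrangeIdeal f :=
      Ideal.subset_span (Or.inl ⟨i, rfl⟩)
    have := add_mem (mem_reducible_of_mem f h) (polyXT_mul_dtPow_mem f (f i) 0)
    simpa [dtPow_zero] using this
  | add_single δ j ih =>
    have h : x K (Sum.inr i) * dtPow K n (δ + Finsupp.single j 1) =
        d K (Sum.inr j) * (x K (Sum.inr i) * dtPow K n δ) -
          (if (Sum.inr j : Fin n ⊕ Fin r) = Sum.inr i then 1 else 0) * dtPow K n δ := by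
      rw [dtPow_add_single, ← mul_assoc (d K _), d_mul_x, add_mul, mul_assoc, add_sub_cancel_right]
    rw [h]
    refine sub_mem (dt_mul_mem_reducible f j ih) ?_
    split_ifs
    · rw [one_mul]; exact dtPow_mem f δ
    · rw [zero_mul]; exact zero_mem _

/-- Since ∂_m commutes with ∂t^δ, it reaches the right end, where the second family of generators
replaces it. -/
theorem d_mul_dtPow_mem (m : Fin n) (δ : Fin r →₀ ℕ) :
    d K (Sum.inl m) * dtPow K n δ ∈ reducible f := by
  induction δ using finsuppNat_induction with
  | zero =>
    have h : d K (Sum.inl m) + ∑ j : Fin r, polyXT r (MvPolynomial.pderiv m (f j)) *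
        d K (Sum.inr j) ∈ malgrangeIdeal f :=
      Ideal.subset_span (Or.inr ⟨m, rfl⟩)
    have h2 : ∑ j : Fin r, polyXT r (MvPolynomial.pderiv m (f j)) * d K (Sum.inr j) ∈
        reducible f := sum_mem fun j _ => by
      have := polyXT_mul_dtPow_mem f (MvPolynomial.pderiv m (f j)) (0 + Finsupp.single j 1)
      rwa [dtPow_add_single, dtPow_zero, mul_one] at this
    have := sub_mem (mem_reducible_of_mem f h) h2
    rwa [add_sub_cancel_right, ← mul_one (d K (Sum.inl m)), ← dtPow_zero] at this
  | add_single δ j ih =>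
    rw [dtPow_add_single, ← mul_assoc, d_mul_d, mul_assoc]
    exact dt_mul_mem_reducible f j ih

/-- The reducible operators contain 1 and are stable under left multiplication by every generator.
-/
theorem mem_reducible (z : WeylAlgebra K (Fin n ⊕ Fin r)) : z ∈ reducible f := by
  rw [← mul_one z]
  refine mul_mem_of_generators (reducible f) ?_ ?_ z 1 (by
    simpa only [dtPow_zero] using dtPow_mem f 0)
  · rintro (m | i) z hz
    · rw [← polyXT_X]
      exact polyXT_mul_mem_reducible f _ hz
    · refine mul_mem_reducible f (fun p δ => ?_) hz
      rw [← mul_assoc, t_mul_polyXT, mul_assoc]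
      exact polyXT_mul_mem_reducible f p (t_mul_dtPow_mem f i δ)
  · rintro (m | i) z hz
    · refine mul_mem_reducible f (fun p δ => ?_) hz
      rw [← mul_assoc, d_mul_polyXT, add_mul, mul_assoc]
      exact add_mem (polyXT_mul_mem_reducible f p (d_mul_dtPow_mem f m δ))
        (polyXT_mul_dtPow_mem f _ δ)
    · exact dt_mul_mem_reducible f i hz

/-! ### Evaluation at `s = a` -/

/-- The embedding of `K[x]` in its field of fractions. -/
def toFrac : MvPolynomial (Fin n) K →ₐ[K] FractionRing (MvPolynomial (Fin n) K) :=
  IsScalarTower.toAlgHom K _ _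

theorem toFrac_injective : Function.Injective (toFrac (K := K) (n := n)) :=
  IsFractionRing.injective _ _

/-- The substitution `s ↦ a` on `K[x, s]`. -/
def evalPoly (a : Fin r → K) : PolyXS K n r →ₐ[K] FractionRing (MvPolynomial (Fin n) K) :=
  MvPolynomial.aeval (Sum.elim (fun m => toFrac (MvPolynomial.X m)) (fun i => algebraMap K _ (a i)))

theorem evalPoly_inclX (a : Fin r → K) (p : MvPolynomial (Fin n) K) :
    evalPoly a (inclX r p) = toFrac p := by
  have : (evalPoly a).comp (inclX r) = toFrac (n := n) := by
    apply MvPolynomial.algHom_ext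
    intro m
    simp [evalPoly, inclX]
  exact DFunLike.congr_fun this p

-- The nonvanishing of the f_i is what keeps the denominators nonzero when s is specialised.
variable {f} in
theorem isUnit_evalPoly (hf : ∀ i, f i ≠ 0) (a : Fin r → K) (y : Submonoid.powers (prodF f)) :
    IsUnit (evalPoly a (y : PolyXS K n r)) := by
  obtain ⟨_, k, rfl⟩ := y
  simp only [map_pow, prodF, map_prod, evalPoly_inclX]
  refine IsUnit.pow k (IsUnit.mk0 _ (Finset.prod_ne_zero_iff.2 fun i _ => ?_))
  rw [map_ne_zero_iff _ toFrac_injective]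
  exact hf i

variable {f}

/-- The substitution `s ↦ a` on `K[x, s, 1/f]`. -/
def evalAt (hf : ∀ i, f i ≠ 0) (a : Fin r → K) :
    ModuleFs f →ₐ[K] FractionRing (MvPolynomial (Fin n) K) :=
  IsLocalization.liftAlgHom (M := Submonoid.powers (prodF f)) (isUnit_evalPoly hf a)

variable (hf : ∀ i, f i ≠ 0)

theorem evalAt_coef (a : Fin r → K) (p : PolyXS K n r) :
    evalAt hf a (coef f p) = evalPoly a p :=
  IsLocalization.lift_eq (isUnit_evalPoly hf a) p

theorem evalAt_sElt (a : Fin r → K) (i : Fin r) :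
    evalAt hf a (sElt f i) = algebraMap K _ (a i) := by
  rw [sElt, evalAt_coef]; simp [evalPoly]

theorem evalAt_shift (a b : Fin r → K) (G : ModuleFs f) :
    evalAt hf a (shift f b G) = evalAt hf (a + b) G := by
  have h : ((evalAt hf a).comp (shift f b)).toRingHom = (evalAt hf (a + b)).toRingHom := by
    apply IsLocalization.ringHom_ext (Submonoid.powers (prodF f))
    apply RingHom.ext
    intro p
    change evalAt hf a (shift f b (coef f p)) = evalAt hf (a + b) (coef f p)
    rw [shift_coef, evalAt_coef, evalAt_coef]
    have h0 : (evalPoly a).comp (shiftPoly n b) = evalPoly (n := n) (a + b) := by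
      apply MvPolynomial.algHom_ext
      rintro (m | i) <;> simp [shiftPoly, evalPoly]
    exact DFunLike.congr_fun h0 p
  exact RingHom.congr_fun h G

theorem evalAt_dtOp (a : Fin r → K) (j : Fin r) (G : ModuleFs f) :
    evalAt hf a (dtOp f j G) =
      -(algebraMap K _ (a j) * evalAt hf a (fInv f j)) * evalAt hf (a + Pi.single j (-1)) G := by
  rw [dtOp_apply, map_mul, map_neg, map_mul, evalAt_sElt, evalAt_shift]

theorem evalAt_fInv_ne_zero (a : Fin r → K) (j : Fin r) : evalAt hf a (fInv f j) ≠ 0 := by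
  intro h
  have := congrArg (evalAt hf a) (fElt_mul_fInv f j)
  rw [map_mul, h, mul_zero, map_one] at this
  exact zero_ne_one this

theorem cast_add_single (ν : Fin r →₀ ℕ) (j : Fin r) :
    (fun i => (((ν + Finsupp.single j 1 : Fin r →₀ ℕ) i : ℕ) : K)) + Pi.single j (-1) =
      fun i => (ν i : K) := by
  funext i
  by_cases h : i = j
  · subst h; simp
  · simp [Finsupp.single_eq_of_ne h, Pi.single_eq_of_ne h]

/-- Up to sign and powers of 1/f_j, the value is the product of the falling factorials ν_j(ν_j -
1)⋯(ν_j - δ_j + 1), which vanishes once some δ_j > ν_j. -/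
theorem evalAt_dtPow_eq_zero (δ ν : Fin r →₀ ℕ) (h : ¬ δ ≤ ν) :
    evalAt hf (fun i => (ν i : K)) (actT f (dtPow K n δ) (genFs f)) = 0 := by
  induction δ using finsuppNat_induction generalizing ν with
  | zero => exact (h zero_le).elim
  | add_single δ j ih =>
    rw [dtPow_add_single, map_mul, Module.End.mul_apply, actT_d_inr, evalAt_dtOp]
    by_cases hν : ν j = 0
    · simp [hν]
    · obtain ⟨ν, rfl⟩ := exists_eq_add_single hν
      rw [cast_add_single, ih ν (fun hle => h (add_le_add_left hle _)), mul_zero]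

/-- At ν = δ the falling factorials become δ_j!, nonzero in characteristic zero. -/
theorem evalAt_dtPow_ne_zero [CharZero K] (δ : Fin r →₀ ℕ) :
    evalAt hf (fun i => (δ i : K)) (actT f (dtPow K n δ) (genFs f)) ≠ 0 := by
  induction δ using finsuppNat_induction with
  | zero => rw [dtPow_zero, map_one, Module.End.one_apply, genFs, map_one]; exact one_ne_zero
  | add_single δ j ih =>
    rw [dtPow_add_single, map_mul, Module.End.mul_apply, actT_d_inr, evalAt_dtOp, cast_add_single]
    refine mul_ne_zero (neg_ne_zero.2 (mul_ne_zero ?_ (evalAt_fInv_ne_zero hf _ j))) ih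
    rw [map_ne_zero]
    simp [Nat.cast_add_one_ne_zero]

/-- The evaluations at s = ν are triangular for the componentwise order, so a minimal exponent in
the support is isolated by evaluating there. -/
theorem normalForm_eq_zero [CharZero K] (hf : ∀ i, f i ≠ 0)
    (c : (Fin r →₀ ℕ) →₀ MvPolynomial (Fin n) K)
    (h : actT f (normalForm c) (genFs f) = 0) : c = 0 := by
  by_contra hc
  obtain ⟨δ, hδ⟩ := c.support.exists_minimal (Finsupp.support_nonempty_iff.2 hc)
  have h1 := congrArg (evalAt hf fun i => (δ i : K)) h
  have h2 : normalForm c = c.sum fun δ p => polyXT r p * dtPow K n δ := rfl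
  rw [h2, Finsupp.sum, map_sum, LinearMap.sum_apply, map_sum, Finset.sum_eq_single δ, map_zero,
    map_mul, Module.End.mul_apply, actT_polyXT, map_mul, evalAt_coef, evalPoly_inclX] at h1
  · refine (mul_ne_zero ?_ (evalAt_dtPow_ne_zero hf δ)) h1
    rw [map_ne_zero_iff _ toFrac_injective]
    exact Finsupp.mem_support_iff.1 hδ.1
  · intro ε hε hne
    rw [map_mul, Module.End.mul_apply, actT_polyXT, map_mul, evalAt_dtPow_eq_zero, mul_zero]
    exact fun hle => hne (le_antisymm hle (hδ.2 hε hle))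
  · exact fun h => (h hδ.1).elim

/-- The Malgrange ideal is the annihilator of `f^s`. -/
theorem malgrangeIdeal_eq_annFs [CharZero K] (hf : ∀ i, f i ≠ 0) :
    malgrangeIdeal f = annFs f := by
  refine le_antisymm (malgrangeIdeal_le_annFs f) fun z hz => ?_
  obtain ⟨_, ⟨c, rfl⟩, y, hy, rfl⟩ := Submodule.mem_sup.1 (mem_reducible f z)
  have hy' : actT f y (genFs f) = 0 := malgrangeIdeal_le_annFs f hy
  rw [mem_annFs, map_add, LinearMap.add_apply, hy', add_zero] at hz
  rw [normalForm_eq_zero hf c hz, map_zero, zero_add]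
  exact hy

end MellinAction

/-! ### From the initial ideal to the functional equation -/

section FunctionalEquation

open WeylAlgebra

attribute [local instance] LieRing.ofAssociativeRing

variable {K : Type*} [Field K] {n r : ℕ} (f : Fin r → MvPolynomial (Fin n) K)

/-- The extra 1, summed over j, is the r in the substitution s ↦ -s - r. -/
theorem tOp_mul_dtOp_apply (j : Fin r) (G : ModuleFs f) :
    tOp f j (dtOp f j G) = -(sElt f j + 1) * G := by
  simp only [tOp_apply, dtOp_apply, map_mul, map_neg, shift_fInv, shift_shift, shift_sElt,
    Pi.single_eq_same, map_one, add_comm (Pi.single j 1 : Fin r → K), single_neg_one_add,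
    shift_zero]
  linear_combination (-((sElt f j + 1) * G)) * fElt_mul_fInv f j

/-- This identity embeds the action of gl_r in the weight-0 part of D_n⟨t, ∂t⟩. -/
theorem dtOp_mul_tOp (i j : Fin r) : dtOp f i * tOp f j = - sOp f i j := by
  ext G
  have h : (Pi.single i (-1) + Pi.single j 1 : Fin r → K) = epsSub K j i := by
    rw [epsSub, sub_eq_add_neg, ← Pi.single_neg, add_comm]
  simp only [Module.End.mul_apply, LinearMap.neg_apply, tOp_apply, dtOp_apply, sOp_apply, map_mul,
    shift_fElt, shift_shift, h]
  ring

theorem actT_euler :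
    actT f (euler K (weightT n r)) =
      Algebra.lmul K (ModuleFs f) (-(∑ i, sElt f i) - algebraMap K _ (r : K)) := by
  ext G
  simp only [euler, weightT, Fintype.sum_sum_type, Sum.elim_inl, Sum.elim_inr, zero_smul, one_smul,
    Finset.sum_const_zero, zero_add, map_sum, map_mul, actT_x_inr, actT_d_inr, LinearMap.sum_apply,
    Module.End.mul_apply, tOp_mul_dtOp_apply, ← Finset.sum_mul, Finset.sum_neg_distrib,
    Finset.sum_add_distrib]
  simp only [Algebra.coe_lmul_eq_mul, LinearMap.mul_apply_apply, Finset.sum_const, Finset.card_univ,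
    Fintype.card_fin, nsmul_eq_mul, mul_one, map_natCast]
  ring

theorem actT_aeval_euler (p : Polynomial K) :
    actT f (Polynomial.aeval (euler K (weightT n r)) p) (genFs f) =
      evalSum f (p.comp (-Polynomial.X - Polynomial.C (r : K))) := by
  rw [← Polynomial.aeval_algHom_apply, actT_euler, Polynomial.aeval_algHom_apply, evalSum,
    Polynomial.aeval_comp, map_sub, map_neg, Polynomial.aeval_X, Polynomial.aeval_C]
  rfl

/-! ### The submodule `∑ D_n⟨S⟩ f_k • f^s` -/

/-- The subspace `∑ k, D_n⟨S⟩ f_k • f^s` of `M`. -/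
def spanFs : Submodule K (ModuleFs f) where
  carrier := {m | ∃ P : Fin r → AlgDS K n r, ∑ k, actDS f (P k * polyDS r (f k)) (genFs f) = m}
  zero_mem' := ⟨0, by simp⟩
  add_mem' := by
    rintro _ _ ⟨P, rfl⟩ ⟨Q, rfl⟩
    exact ⟨P + Q, by simp [add_mul, Finset.sum_add_distrib]⟩
  smul_mem' := by
    rintro c _ ⟨P, rfl⟩
    exact ⟨c • P, by simp [Finset.smul_sum]⟩

theorem functionalEquation_iff (b : Polynomial K) :
    FunctionalEquation f b ↔ evalSum f b ∈ spanFs f := Iff.rfl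

theorem actDS_mem_spanFs (Q : AlgDS K n r) {m : ModuleFs f} (hm : m ∈ spanFs f) :
    actDS f Q m ∈ spanFs f := by
  obtain ⟨P, rfl⟩ := hm
  refine ⟨fun k => Q * P k, ?_⟩
  rw [map_sum]
  refine Finset.sum_congr rfl fun k _ => ?_
  rw [mul_assoc, map_mul, Module.End.mul_apply]

theorem actDS_tmul (P : WeylAlgebra K (Fin n)) (Q : AlgS K r) :
    actDS f (TensorProduct.tmul K P Q) = actD f P * actS f Q :=
  Algebra.TensorProduct.lift_tmul ..

theorem actS_ι_single (i j : Fin r) :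
    actS f (UniversalEnvelopingAlgebra.ι K (Matrix.single i j (1 : K))) = sOp f i j := by
  rw [actS, UniversalEnvelopingAlgebra.lift_ι_apply]
  exact actGLLin_single f i j

theorem actDS_polyDS (p : MvPolynomial (Fin n) K) (G : ModuleFs f) :
    actDS f (polyDS r p) G = coef f (inclX r p) * G := by
  rw [polyDS, actDS_tmul, map_one, mul_one, actD_ofPoly]

theorem dOp_mem_spanFs (m : Fin n) {G : ModuleFs f} (hG : G ∈ spanFs f) :
    dOp f m G ∈ spanFs f := by
  have : dOp f m = actDS f (TensorProduct.tmul K (d K m) 1) := by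
    rw [actDS_tmul, map_one, mul_one, actD, lift_d]
  rw [this]
  exact actDS_mem_spanFs f _ hG

theorem sOp_mem_spanFs (i j : Fin r) {G : ModuleFs f} (hG : G ∈ spanFs f) :
    sOp f i j G ∈ spanFs f := by
  have : sOp f i j = actDS f (TensorProduct.tmul K 1
      (UniversalEnvelopingAlgebra.ι K (Matrix.single i j (1 : K)))) := by
    rw [actDS_tmul, map_one, one_mul, actS_ι_single]
  rw [this]
  exact actDS_mem_spanFs f _ hG

theorem coef_mul_mem_spanFs (g : MvPolynomial (Fin n) K) (k : Fin r) :
    coef f (inclX r (f k * g)) ∈ spanFs f := by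
  classical
  refine ⟨Pi.single k (polyDS r g), ?_⟩
  rw [Finset.sum_eq_single k]
  · rw [Pi.single_eq_same, map_mul, Module.End.mul_apply, actDS_polyDS, actDS_polyDS, genFs,
      mul_one, map_mul, map_mul, mul_comm]
  · intro i _ hi
    rw [Pi.single_eq_of_ne hi, zero_mul, map_zero, LinearMap.zero_apply]
  · simp

theorem actT_xPow (α : Fin n ⊕ Fin r →₀ ℕ) :
    ∃ g : MvPolynomial (Fin n) K, actT f (xPow K α) (genFs f) = coef f (inclX r g) := by
  induction α using finsuppNat_induction with
  | zero => exact ⟨1, by simp [xPow_zero, genFs]⟩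
  | add_single α i ih =>
    obtain ⟨g, hg⟩ := ih
    rw [xPow_add_single, map_mul, Module.End.mul_apply, hg]
    rcases i with m | j
    · refine ⟨MvPolynomial.X m * g, ?_⟩
      rw [actT_x_inl, xOp_apply, map_mul, map_mul, xElt, inclX, MvPolynomial.rename_X]
    · refine ⟨f j * g, ?_⟩
      rw [actT_x_inr, tOp_apply, shift_coef_inclX, map_mul, map_mul, fElt]

theorem exists_inr_ne_zero {α β : Fin n ⊕ Fin r →₀ ℕ} (h : weight (weightT n r) (α, β) < 0) :
    ∃ k, α (Sum.inr k) ≠ 0 := by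
  by_contra! hα
  refine h.not_ge ?_
  rw [weight, Fintype.sum_sum_type]
  simp [weightT, hα, Finset.sum_nonneg]

/-- Induction on β, bringing one derivative to the front. A ∂_m is already in D_n; for a ∂t_j the
negative weight guarantees some t_k in x^α, and ∂t_j t_k = -s_jk uses up both without changing the
weight. -/
theorem actT_monomial_mem_spanFs (α β : Fin n ⊕ Fin r →₀ ℕ)
    (h : weight (weightT n r) (α, β) < 0) :
    actT f (xPow K α * dPow K β) (genFs f) ∈ spanFs f := by
  induction β using finsuppNat_induction generalizing α with
  | zero =>
    obtain ⟨k, hk⟩ := exists_inr_ne_zero h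
    obtain ⟨α, rfl⟩ := exists_eq_add_single hk
    obtain ⟨g, hg⟩ := actT_xPow f α
    rw [dPow_zero, mul_one, xPow_add_single, map_mul, Module.End.mul_apply, hg, actT_x_inr,
      tOp_apply, shift_coef_inclX, fElt, ← map_mul, ← map_mul]
    exact coef_mul_mem_spanFs f g k
  | add_single β i ih =>
    have hcomm : xPow K α * dPow K (β + Finsupp.single i 1) =
        d K i * (xPow K α * dPow K β) -
          α i • (xPow K (α - Finsupp.single i 1) * dPow K β) := by
      rw [dPow_add_single, ← mul_assoc, ← mul_assoc (d K i), d_mul_xPow, add_mul, smul_mul_assoc,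
        add_sub_cancel_right]
    have hlow : actT f (α i • (xPow K (α - Finsupp.single i 1) * dPow K β)) (genFs f) ∈
        spanFs f := by
      by_cases hα : α i = 0
      · simp [hα]
      · obtain ⟨α, rfl⟩ := exists_eq_add_single hα
        rw [map_nsmul, LinearMap.smul_apply, add_tsub_cancel_right]
        refine nsmul_mem (ih α ?_) _
        rwa [weight_add_single_left, weight_add_single_right, add_sub_cancel_right] at h
    rw [hcomm, map_sub, LinearMap.sub_apply]
    refine sub_mem ?_ hlow
    rcases i with m | j
    · rw [map_mul, Module.End.mul_apply, actT_d_inl]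
      refine dOp_mem_spanFs f m (ih α ?_)
      rw [weight_add_single_right] at h
      simpa [weightT] using h
    · obtain ⟨k, hk⟩ := exists_inr_ne_zero h
      obtain ⟨α, rfl⟩ := exists_eq_add_single hk
      rw [xPow_add_single, mul_assoc, ← mul_assoc, map_mul, Module.End.mul_apply, map_mul,
        actT_d_inr, actT_x_inr, dtOp_mul_tOp, LinearMap.neg_apply]
      refine neg_mem (sOp_mem_spanFs f j k (ih α ?_))
      rw [weight_add_single_left, weight_add_single_right] at h
      simpa [weightT] using h

variable (K) in
/-- The map `z ↦ z • f^s`. -/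
def actGen : WeylAlgebra K (Fin n ⊕ Fin r) →ₗ[K] ModuleFs f :=
  LinearMap.applyₗ (genFs f) ∘ₗ (actT f).toLinearMap

theorem actGen_apply (z : WeylAlgebra K (Fin n ⊕ Fin r)) :
    actGen K f z = actT f z (genFs f) := rfl

/-- The generators x_m, ∂_m and s_ij = -∂t_i t_j all come from operators of weight 0, so they
preserve the image of the negative weights. -/
theorem actDS_mem_map_weightSpan (Q : AlgDS K n r) {m : ModuleFs f}
    (hm : m ∈ (weightSpan (K := K) (weightT n r) (Set.Iio 0)).map (actGen K f)) :
    actDS f Q m ∈ (weightSpan (K := K) (weightT n r) (Set.Iio 0)).map (actGen K f) := by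
  set N := (weightSpan (K := K) (weightT n r) (Set.Iio 0)).map (actGen K f) with hN
  let S : Subalgebra K (Module.End K (ModuleFs f)) :=
    { carrier := {T | ∀ m ∈ N, T m ∈ N}
      mul_mem' := fun {a b} ha hb m hm => ha _ (hb m hm)
      add_mem' := fun {a b} ha hb m hm => N.add_mem (ha m hm) (hb m hm)
      algebraMap_mem' := fun c m hm => N.smul_mem c hm }
  have hx : ∀ i, xOp f i ∈ S := by
    rintro i _ ⟨z, hz, rfl⟩
    refine ⟨x K (Sum.inl i) * z, x_mul_mem_weightSpan _ (fun k hk => ?_) hz, ?_⟩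
    · simpa [weightT] using hk
    · rw [actGen_apply, map_mul, Module.End.mul_apply, actT_x_inl, actGen_apply]
  have hd : ∀ i, dOp f i ∈ S := by
    rintro i _ ⟨z, hz, rfl⟩
    refine ⟨d K (Sum.inl i) * z, d_mul_mem_weightSpan _ (fun k hk => ?_) hz, ?_⟩
    · simpa [weightT] using hk
    · rw [actGen_apply, map_mul, Module.End.mul_apply, actT_d_inl, actGen_apply]
  have hs : ∀ i j, sOp f i j ∈ S := by
    rintro i j _ ⟨z, hz, rfl⟩
    -- Multiplication by t_j brings the weight below -1, and ∂t_i then raises it by one, still below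
    -- 0.
    refine ⟨-(d K (Sum.inr i) * (x K (Sum.inr j) * z)), neg_mem (d_mul_mem_weightSpan
      (S := Set.Iio (-1)) _ (fun k hk => ?_) (x_mul_mem_weightSpan _ (fun k hk => ?_) hz)), ?_⟩
    · simp only [weightT, Sum.elim_inr, Set.mem_Iio, Nat.cast_one] at hk ⊢
      omega
    · simp only [weightT, Sum.elim_inr, Set.mem_Iio, Nat.cast_one] at hk ⊢
      omega
    · rw [actGen_apply, ← mul_assoc, map_neg, map_mul, map_mul, actT_d_inr, actT_x_inr,
        dtOp_mul_tOp, LinearMap.neg_apply, Module.End.mul_apply, LinearMap.neg_apply, neg_neg,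
        actGen_apply]
  have hD : ∀ P, actD f P ∈ S := fun P =>
    mem_of_generators (S.comap (actD f))
      (fun i => by rw [Subalgebra.mem_comap, actD, lift_x]; exact hx i)
      (fun i => by rw [Subalgebra.mem_comap, actD, lift_d]; exact hd i) P
  have hGL : ∀ A : Glr K r, actGL f A ∈ S := fun A =>
    S.sum_mem fun i _ => S.sum_mem fun j _ => S.smul_mem (hs i j) _
  have hS : ∀ P, actS f P ∈ S := by
    intro P
    let g : Glr K r →ₗ⁅K⁆ S :=
      { toFun := fun A => ⟨actGL f A, hGL A⟩
        map_add' := fun A B => Subtype.ext (map_add _ A B)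
        map_smul' := fun c A => Subtype.ext (map_smul _ c A)
        map_lie' := fun {A B} => Subtype.ext (LieHom.map_lie _ A B) }
    have h : S.val.comp (UniversalEnvelopingAlgebra.lift K g) = actS f := by
      apply UniversalEnvelopingAlgebra.hom_ext
      ext A
      simp [actS, g]
    rw [← h]
    exact (UniversalEnvelopingAlgebra.lift K g P).2
  suffices actDS f Q ∈ S from this m hm
  induction Q using TensorProduct.induction_on with
  | zero => rw [map_zero]; exact S.zero_mem
  | tmul P P' => rw [actDS_tmul]; exact S.mul_mem (hD P) (hS P')
  | add P P' hP hP' => rw [map_add]; exact S.add_mem hP hP'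

theorem map_actGen_weightSpan :
    (weightSpan (K := K) (weightT n r) (Set.Iio 0)).map (actGen K f) = spanFs f := by
  apply le_antisymm
  · rw [weightSpan, Submodule.map_span, Submodule.span_le]
    rintro _ ⟨_, ⟨⟨α, β⟩, hm, rfl⟩, rfl⟩
    exact actT_monomial_mem_spanFs f α β hm
  · rintro _ ⟨P, rfl⟩
    refine sum_mem fun k _ => ?_
    rw [map_mul, Module.End.mul_apply]
    -- The element f_k f^s equals t_k • f^s, and t_k has weight -1.
    refine actDS_mem_map_weightSpan f _ ⟨x K (Sum.inr k) * 1,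
      x_mul_mem_weightSpan (S := {0}) _ (fun k hk => ?_) (one_mem_weightSpan rfl), ?_⟩
    · rw [Set.mem_singleton_iff] at hk
      simp [hk, weightT]
    · rw [mul_one, actGen_apply, actT_x_inr, tOp_apply, actDS_polyDS, genFs, map_one, fElt]

-- Since I_f annihilates exactly f^s, congruence of p(θ) to some q of negative weight means p(θ) •
-- f^s = q • f^s, and such q • f^s fill ∑ D_n⟨S⟩ f_k • f^s.
variable {f} in
theorem aeval_euler_mem_initialIdeal_iff [CharZero K] (hf : ∀ i, f i ≠ 0) (p : Polynomial K) :
    Polynomial.aeval (euler K (weightT n r)) p ∈ initialIdeal (weightT n r) (malgrangeIdeal f) ↔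
      FunctionalEquation f (p.comp (-Polynomial.X - Polynomial.C (r : K))) := by
  rw [mem_initialIdeal_iff _ _ (aeval_euler_mem_weightSpan _ p), functionalEquation_iff,
    ← map_actGen_weightSpan, malgrangeIdeal_eq_annFs hf, ← actT_aeval_euler, Submodule.mem_map]
  refine exists_congr fun q => and_congr_right fun _ => ?_
  rw [mem_annFs, map_sub, LinearMap.sub_apply, sub_eq_zero, actGen_apply]
  exact eq_comm

/-! ### The ideal of solutions of the functional equation -/

theorem FunctionalEquation.add {b c : Polynomial K} (hb : FunctionalEquation f b)
    (hc : FunctionalEquation f c) : FunctionalEquation f (b + c) := by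
  rw [functionalEquation_iff] at *
  rw [evalSum, map_add, add_mul]
  exact add_mem hb hc

/-- Multiplication by s_1 + ⋯ + s_r is the action of ∑ s_ii, which stays inside D_n⟨S⟩. -/
theorem FunctionalEquation.mul_left {b : Polynomial K} (hb : FunctionalEquation f b)
    (q : Polynomial K) : FunctionalEquation f (q * b) := by
  rw [functionalEquation_iff] at *
  induction q using Polynomial.induction_on' with
  | add p q hp hq =>
    rw [add_mul, evalSum, map_add, add_mul]
    exact add_mem hp hq
  | monomial k c =>
    rw [← Polynomial.C_mul_X_pow_eq_monomial, mul_assoc, evalSum, map_mul, Polynomial.aeval_C,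
      ← Algebra.smul_def, smul_mul_assoc]
    refine Submodule.smul_mem _ c ?_
    induction k with
    | zero => rwa [pow_zero, one_mul]
    | succ k ih =>
      have h : ∀ i, sOp f i i = Algebra.lmul K (ModuleFs f) (sElt f i) := by
        intro i
        ext G
        rw [sOp_apply, epsSub, sub_self, shift_zero, mul_assoc (sElt f i), fElt_mul_fInv, mul_one]
        rfl
      rw [pow_succ', mul_assoc, map_mul, Polynomial.aeval_X, mul_assoc, Finset.sum_mul]
      refine sum_mem fun i _ => ?_
      have := sOp_mem_spanFs f i i ih
      rwa [h] at this

/-- The Bernstein-Sato polynomial is the monic generator of the ideal of polynomials satisfying the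
functional equation. -/
theorem isBernsteinSatoPolynomial_iff (b : Polynomial K) :
    IsBernsteinSatoPolynomial f b ↔ b.Monic ∧ ∀ c, FunctionalEquation f c ↔ b ∣ c := by
  constructor
  · rintro ⟨hm, hb, hmin⟩
    refine ⟨hm, fun c => ⟨fun hc => ?_, ?_⟩⟩
    · rw [← Polynomial.modByMonic_eq_zero_iff_dvd hm]
      by_contra hne
      have hrem : FunctionalEquation f (c %ₘ b) := by
        rw [Polynomial.modByMonic_eq_sub_mul_div, sub_eq_add_neg, mul_comm, ← neg_mul]
        exact hc.add f (hb.mul_left f _)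
      have hlead : (c %ₘ b).leadingCoeff ≠ 0 := Polynomial.leadingCoeff_ne_zero.2 hne
      have h1 := hmin _ (Polynomial.monic_C_mul_of_mul_leadingCoeff_eq_one
        (inv_mul_cancel₀ hlead)) (hrem.mul_left f (Polynomial.C (c %ₘ b).leadingCoeff⁻¹))
      rw [Polynomial.natDegree_C_mul (inv_ne_zero hlead)] at h1
      -- The strict inequality of natural degrees fails for b = 1, but then the remainder is zero.
      have h2 : b ≠ 1 := by
        rintro rfl
        exact hne (Polynomial.modByMonic_one c)
      exact absurd (Polynomial.natDegree_modByMonic_lt c hm h2) h1.not_gt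
    · rintro ⟨q, rfl⟩
      rw [mul_comm]
      exact hb.mul_left f q
  · rintro ⟨hm, h⟩
    exact ⟨hm, (h b).2 dvd_rfl, fun c hc hfc =>
      Polynomial.natDegree_le_of_dvd ((h c).1 hfc) hc.ne_zero⟩

/-! ### The involution s ↦ -s - a and the comparison of generators -/

theorem neg_X_sub_C_comp_self (a : K) :
    (-Polynomial.X - Polynomial.C a).comp (-Polynomial.X - Polynomial.C a) = Polynomial.X := by
  simp

theorem comp_neg_X_sub_C_comp (p : Polynomial K) (a : K) :
    (p.comp (-Polynomial.X - Polynomial.C a)).comp (-Polynomial.X - Polynomial.C a) = p := by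
  rw [Polynomial.comp_assoc, neg_X_sub_C_comp_self, Polynomial.comp_X]

theorem comp_neg_X_sub_C_dvd_iff (p q : Polynomial K) (a : K) :
    p.comp (-Polynomial.X - Polynomial.C a) ∣ q.comp (-Polynomial.X - Polynomial.C a) ↔ p ∣ q := by
  have key : ∀ p q : Polynomial K, p ∣ q →
      p.comp (-Polynomial.X - Polynomial.C a) ∣ q.comp (-Polynomial.X - Polynomial.C a) := by
    rintro p _ ⟨q, rfl⟩
    rw [Polynomial.mul_comp]
    exact dvd_mul_right _ _
  refine ⟨fun h => ?_, key p q⟩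
  simpa only [comp_neg_X_sub_C_comp] using key _ _ h

theorem neg_X_sub_C_eq (a : K) :
    (-Polynomial.X - Polynomial.C a : Polynomial K) = -(Polynomial.X + Polynomial.C a) := by
  ring

theorem natDegree_neg_X_sub_C (a : K) :
    (-Polynomial.X - Polynomial.C a : Polynomial K).natDegree = 1 := by
  rw [neg_X_sub_C_eq, Polynomial.natDegree_neg, Polynomial.natDegree_X_add_C]

/-- The substitution multiplies the leading coefficient by (-1)^deg, which the sign undoes. -/
theorem monic_comp_neg_X_sub_C_iff (p : Polynomial K) (a : K) :
    ((-1) ^ p.natDegree * p.comp (-Polynomial.X - Polynomial.C a)).Monic ↔ p.Monic := by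
  rw [Polynomial.Monic, Polynomial.Monic, Polynomial.leadingCoeff_mul,
    Polynomial.leadingCoeff_comp (by rw [natDegree_neg_X_sub_C]; exact one_ne_zero),
    neg_X_sub_C_eq, Polynomial.leadingCoeff_neg, Polynomial.leadingCoeff_X_add_C,
    Polynomial.leadingCoeff_pow, Polynomial.leadingCoeff_neg, Polynomial.leadingCoeff_one,
    mul_left_comm, ← mul_pow]
  simp

theorem natDegree_neg_one_pow_mul_comp (k : ℕ) (p : Polynomial K) (a : K) :
    ((-1) ^ k * p.comp (-Polynomial.X - Polynomial.C a)).natDegree = p.natDegree := by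
  have h : ((-1) ^ k : Polynomial K) = Polynomial.C ((-1) ^ k) := by simp
  rw [h, Polynomial.natDegree_C_mul (pow_ne_zero _ (neg_ne_zero.2 one_ne_zero)),
    Polynomial.natDegree_comp, natDegree_neg_X_sub_C, mul_one]

-- Both sides say that a monic polynomial generates an ideal, and the involution s ↦ -s - r
-- exchanges the two ideals; the sign is a unit.
variable {f} in
theorem isGlobalBFunction_iff [CharZero K] (hf : ∀ i, f i ≠ 0) (B : Polynomial K) :
    IsGlobalBFunction (weightT n r) (malgrangeIdeal f) B ↔
      IsBernsteinSatoPolynomial f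
        ((-1) ^ B.natDegree * B.comp (-Polynomial.X - Polynomial.C (r : K))) := by
  have hu : IsUnit ((-1) ^ B.natDegree : Polynomial K) := isUnit_one.neg.pow _
  rw [isBernsteinSatoPolynomial_iff, IsGlobalBFunction, monic_comp_neg_X_sub_C_iff]
  refine and_congr_right fun _ => ?_
  simp only [aeval_euler_mem_initialIdeal_iff hf, hu.mul_left_dvd]
  constructor
  · intro h c
    have := h (c.comp (-Polynomial.X - Polynomial.C (r : K)))
    rw [comp_neg_X_sub_C_comp] at this
    rw [this, ← comp_neg_X_sub_C_dvd_iff _ _ (r : K), comp_neg_X_sub_C_comp]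
  · intro h p
    rw [h, comp_neg_X_sub_C_dvd_iff]

theorem IsBernsteinSatoPolynomial.eq {b c : Polynomial K} (hb : IsBernsteinSatoPolynomial f b)
    (hc : IsBernsteinSatoPolynomial f c) : b = c := by
  have hb' := (isBernsteinSatoPolynomial_iff f b).1 hb
  have hc' := (isBernsteinSatoPolynomial_iff f c).1 hc
  exact Polynomial.eq_of_monic_of_associated hb.1 hc.1
    (associated_of_dvd_dvd ((hb'.2 c).1 hc.2.1) ((hc'.2 b).1 hb.2.1))

end FunctionalEquation

end BernsteinSato

end

theorem lemma8p5 {K : Type*} [Field K] [CharZero K] {n r : ℕ} (hn : 0 < n) (hr : 0 < r)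
    (f : Fin r → MvPolynomial (Fin n) K) (hf : ∀ i, f i ≠ 0) :
    (∀ B : Polynomial K,
      BernsteinSato.WeylAlgebra.IsGlobalBFunction (BernsteinSato.weightT n r)
          (BernsteinSato.malgrangeIdeal f) B ↔
        BernsteinSato.IsBernsteinSatoPolynomial f
          ((-1) ^ B.natDegree * B.comp (-Polynomial.X - Polynomial.C (r : K)))) ∧
    ∀ B : Polynomial K,
      B = BernsteinSato.WeylAlgebra.globalBFunction (BernsteinSato.weightT n r)
        (BernsteinSato.malgrangeIdeal f) →
      BernsteinSato.bernsteinSatoPolynomial f =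
        (-1) ^ B.natDegree * B.comp (-Polynomial.X - Polynomial.C (r : K)) := by
  classical
  refine ⟨BernsteinSato.isGlobalBFunction_iff hf, ?_⟩
  rintro _ rfl
  by_cases h : ∃ B, BernsteinSato.WeylAlgebra.IsGlobalBFunction (BernsteinSato.weightT n r)
      (BernsteinSato.malgrangeIdeal f) B
  · have hB := (BernsteinSato.isGlobalBFunction_iff hf _).1 h.choose_spec
    have h' : ∃ b, BernsteinSato.IsBernsteinSatoPolynomial f b := ⟨_, hB⟩
    rw [BernsteinSato.bernsteinSatoPolynomial, dif_pos h',
      BernsteinSato.WeylAlgebra.globalBFunction, dif_pos h]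
    exact h'.choose_spec.eq f hB
  -- Without a b-function both sides are the default value 0; a Bernstein–Sato polynomial would give
  -- a b-function by applying the involution again.
  · have h' : ¬ ∃ b, BernsteinSato.IsBernsteinSatoPolynomial f b := by
      rintro ⟨b, hb⟩
      set B := (-1) ^ b.natDegree * b.comp (-Polynomial.X - Polynomial.C (r : K)) with hBdef
      refine h ⟨B, (BernsteinSato.isGlobalBFunction_iff hf B).2 ?_⟩
      have hcomp : (-1) ^ B.natDegree * B.comp (-Polynomial.X - Polynomial.C (r : K)) = b := by
        rw [hBdef, BernsteinSato.natDegree_neg_one_pow_mul_comp, Polynomial.mul_comp,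
          BernsteinSato.comp_neg_X_sub_C_comp]
        simp [← mul_assoc, ← mul_pow]
      rwa [hcomp]
    rw [BernsteinSato.bernsteinSatoPolynomial, dif_neg h',
      BernsteinSato.WeylAlgebra.globalBFunction, dif_neg h]
    simp
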